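/- Let $K$ be an algebraically closed field of characteristic zero, let $n\ge 1$, and let $P$ be the upper-block parabolic subgroup of $\mathrm{GL}_n(K)$ with block sizes $(b_1,\dots,b_p)$, where $b_i\ge 1$ and $b_1+\dots+b_p=n$. Let $\mathfrak p$ be its Lie algebra (all upper-block triangular $n\times n$ matrices with these block sizes), and let $\mathcal N_{\mathfrak p}$ be the variety of nilpotent matrices in $\mathfrak p$, on which $P$ acts by conjugation. Let $$\mathcal C(\mathcal N_{\mathfrak p})=\{(x,y)\in\mathcal N_{\mathfrak p}\times\mathcal N_{\mathfrak p} : [x,y]=0\}$$ be the nilpotent commuting variety, with its Zariski topology. For $x\in\mathcal N_{\mathfrak p}$ put $\mathfrak p^x=\{y\in\mathfrak p : [x,y]=0\}$; call $x$ distinguished if $\mathfrak p^x\cap\mathfrak{sl}_n\subseteq\mathcal N_{\mathfrak p}$, and call a $P$-orbit in $\mathcal N_{\mathfrak p}$ distinguished if all of its elements are distinguished. 1. If $P$ acts on $\mathcal N_{\mathfrak p}$ with finitely many orbits, then $\dim\mathcal C(\mathcal N_{\mathfrak p})=\dim\mathfrak p-1$. Moreover, the irreducible components of $\mathcal C(\mathcal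 N_{\mathfrak p})$ of maximal dimension are in one-to-one correspondence with the distinguished $P$-orbits in $\mathcal N_{\mathfrak p}$: the map sending a distinguished orbit $O$ to the closure in $\mathcal C(\mathcal N_{\mathfrak p})$ of $\{(x,y)\in\mathcal C(\mathcal N_{\mathfrak p}) : x\in O\}$ is a bijection onto the set of irreducible components of dimension $\dim\mathcal C(\mathcal N_{\mathfrak p})$. 2. If there are infinitely many distinguished $P$-orbits in $\mathcal N_{\mathfrak p}$, then $\dim\mathcal C(\mathcal N_{\mathfrak p})\ge\dim\mathfrak p$. -/

import Mathlib

attribute [local instance 100] LieRing.ofAssociativeRing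

namespace ParabolicCommuting

/-! ### The Zariski topology -/

/-- The Zariski topology on the affine space `σ → K` (for `σ` finite): the closed sets are the
common zero sets of ideals of polynomials. -/
@[reducible] def zariskiTopology (K σ : Type*) [Field K] : TopologicalSpace (σ → K) :=
  TopologicalSpace.ofClosed
    {Z | ∃ I : Ideal (MvPolynomial σ K), Z = MvPolynomial.zeroLocus K I}
    ⟨⊤, by simp⟩
    (by
      intro A hA
      refine ⟨MvPolynomial.vanishingIdeal K (⋂₀ A), ?_⟩
      refine Set.Subset.antisymm (MvPolynomial.zeroLocus_vanishingIdeal_le _) ?_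
      refine Set.subset_sInter fun Z hZ => ?_
      obtain ⟨I, rfl⟩ := hA hZ
      exact MvPolynomial.zeroLocus_anti_mono
        (MvPolynomial.le_zeroLocus_iff_le_vanishingIdeal.1 (Set.sInter_subset_of_mem hZ)))
    (by
      rintro _ ⟨I, rfl⟩ _ ⟨J, rfl⟩
      refine ⟨I * J, Set.Subset.antisymm ?_ ?_⟩
      · rintro x (hx | hx)
        · exact MvPolynomial.zeroLocus_anti_mono Ideal.mul_le_left hx
        · exact MvPolynomial.zeroLocus_anti_mono Ideal.mul_le_right hx
      · intro x hx
        by_contra h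
        simp only [Set.mem_union, MvPolynomial.mem_zeroLocus_iff, not_or, not_forall] at h
        obtain ⟨⟨p, hp, hpx⟩, q, hq, hqx⟩ := h
        have := hx (p * q) (Ideal.mul_mem_mul hp hq)
        rw [map_mul] at this
        exact (mul_ne_zero hpx hqx) this)

theorem isClosed_zariskiTopology_iff {K σ : Type*} [Field K] (Z : Set (σ → K)) :
    @IsClosed _ (zariskiTopology K σ) Z ↔
      ∃ I : Ideal (MvPolynomial σ K), Z = MvPolynomial.zeroLocus K I := by
  rw [← @isOpen_compl_iff _ _ (zariskiTopology K σ)]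
  change Zᶜᶜ ∈ {Z | ∃ I : Ideal (MvPolynomial σ K), Z = MvPolynomial.zeroLocus K I} ↔ _
  rw [compl_compl]
  rfl

/-- The coordinates (matrix entries) of a pair of `n × n` matrices. -/
def pairCoordinates {K : Type*} {n : ℕ}
    (z : Matrix (Fin n) (Fin n) K × Matrix (Fin n) (Fin n) K) :
    (Fin n × Fin n) ⊕ (Fin n × Fin n) → K :=
  Sum.elim (fun ij => z.1 ij.1 ij.2) (fun ij => z.2 ij.1 ij.2)

section

variable (K : Type*) [Field K] {n : ℕ} (c : Composition n)

/-! ### The parabolic subgroup, its Lie algebra, and the nilpotent cone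

A composition `c` of `n` is the vector `(b₁, …, b_p)` of (positive) block sizes, and `c.index i` is
the number of the block that contains `i`. -/

/-- The upper-block parabolic subgroup `P` of `GL_n(K)` with block sizes `c`. -/
def parabolic : Subgroup (GL (Fin n) K) where
  carrier := {g | (g : Matrix (Fin n) (Fin n) K).BlockTriangular c.index}
  mul_mem' := by
    intro a b ha hb
    simpa using Matrix.BlockTriangular.mul ha hb
  one_mem' := by
    simpa using Matrix.blockTriangular_one
  inv_mem' := by
    intro a ha
    have ha' : (a : Matrix (Fin n) (Fin n) K).BlockTriangular c.index := ha
    change ((a⁻¹ : GL (Fin n) K) : Matrix (Fin n) (Fin n) K).BlockTriangular c.index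
    rw [Matrix.coe_units_inv]
    have : Invertible (a : Matrix (Fin n) (Fin n) K) := a.invertible
    exact Matrix.blockTriangular_inv_of_blockTriangular ha'

/-- The Lie algebra `𝔭` of `P`: all upper-block triangular matrices with block sizes `c`. -/
def parabolicLie : LieSubalgebra K (Matrix (Fin n) (Fin n) K) where
  carrier := {x | x.BlockTriangular c.index}
  add_mem' := fun ha hb => Matrix.BlockTriangular.add ha hb
  zero_mem' := Matrix.blockTriangular_zero
  smul_mem' := by
    intro r x hx i j hij
    simp [hx hij]
  lie_mem' := by
    intro x y hx hy
    rw [Ring.lie_def]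
    exact Matrix.BlockTriangular.sub (Matrix.BlockTriangular.mul hx hy)
      (Matrix.BlockTriangular.mul hy hx)

/-- The nilpotent cone `N_𝔭` of `𝔭`: the nilpotent matrices in `𝔭`. -/
def nilpotentCone : Set (Matrix (Fin n) (Fin n) K) :=
  {x | x ∈ parabolicLie K c ∧ IsNilpotent x}

/-- `P` acts on `N_𝔭` by conjugation, `g • x = g x g⁻¹`. -/
instance : MulAction (parabolic K c) (nilpotentCone K c) where
  smul g x := ⟨(g : GL (Fin n) K).val * x.val * ((g : GL (Fin n) K)⁻¹).val,
    ⟨Matrix.BlockTriangular.mul (Matrix.BlockTriangular.mul g.2 x.2.1)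
      ((parabolic K c).inv_mem g.2), by
      obtain ⟨k, hk⟩ := x.2.2
      refine ⟨k, ?_⟩
      rw [Units.conj_pow, hk]
      simp⟩⟩
  one_smul x := Subtype.ext (by
    change (1 : GL (Fin n) K).val * x.val * ((1 : GL (Fin n) K)⁻¹).val = x.val
    simp)
  mul_smul g h x := Subtype.ext (by
    change ((g : GL (Fin n) K) * h).val * x.val * (((g : GL (Fin n) K) * h)⁻¹).val =
      (g : GL (Fin n) K).val * ((h : GL (Fin n) K).val * x.val * ((h : GL (Fin n) K)⁻¹).val) *
        ((g : GL (Fin n) K)⁻¹).val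
    rw [mul_inv_rev, Units.val_mul, Units.val_mul]
    simp only [mul_assoc])

theorem val_smul_nilpotentCone (g : parabolic K c) (x : nilpotentCone K c) :
    (g • x).val = (g : GL (Fin n) K).val * x.val * ((g : GL (Fin n) K)⁻¹).val :=
  rfl

/-- The set of `P`-orbits in `N_𝔭`. -/
abbrev NilpotentOrbit : Type _ :=
  MulAction.orbitRel.Quotient (parabolic K c) (nilpotentCone K c)

/-! ### Distinguished elements and orbits -/

/-- The centralizer `𝔭^x = {y ∈ 𝔭 | [x, y] = 0}`. -/
def parabolicCentralizer (x : Matrix (Fin n) (Fin n) K) : Set (Matrix (Fin n) (Fin n) K) :=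
  {y | y ∈ parabolicLie K c ∧ ⁅x, y⁆ = 0}

/-- `x ∈ N_𝔭` is distinguished if `𝔭^x ∩ 𝔰𝔩_n ⊆ N_𝔭`. -/
def IsDistinguished (x : nilpotentCone K c) : Prop :=
  parabolicCentralizer K c x ∩ (LieAlgebra.SpecialLinear.sl (Fin n) K : Set _) ⊆ nilpotentCone K c

/-- The distinguished orbits: those all of whose elements are distinguished. -/
def distinguishedOrbits : Set (NilpotentOrbit K c) :=
  {O | ∀ x ∈ O.orbit, IsDistinguished K c x}

/-! ### The nilpotent commuting variety -/

/-- The nilpotent commuting variety `C(N_𝔭) = {(x, y) ∈ N_𝔭 × N_𝔭 | [x, y] = 0}`. -/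
def NilpotentCommutingVariety : Type _ :=
  {z : Matrix (Fin n) (Fin n) K × Matrix (Fin n) (Fin n) K //
    z.1 ∈ nilpotentCone K c ∧ z.2 ∈ nilpotentCone K c ∧ ⁅z.1, z.2⁆ = 0}

/-- `C(N_𝔭)` carries the Zariski topology, as a subset of the affine space of pairs of matrices. -/
instance : TopologicalSpace (NilpotentCommutingVariety K c) :=
  (zariskiTopology K _).induced (fun z => pairCoordinates z.val)

/-- The first component `(x, y) ↦ x` as a map from `C(N_𝔭)` to `N_𝔭`. -/
def NilpotentCommutingVariety.fst (z : NilpotentCommutingVariety K c) : nilpotentCone K c :=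
  ⟨z.val.1, z.property.1⟩

/-- The part of `C(N_𝔭)` over an orbit `O = P.x`, that is, the pairs `(x', y)` with `x' ∈ O`; this is
`P.(x, 𝔭^x ∩ N_𝔭)`. -/
def commutingPairsOver (O : NilpotentOrbit K c) : Set (NilpotentCommutingVariety K c) :=
  {z | z.fst ∈ O.orbit}

/-- The irreducible components of `C(N_𝔭)` whose dimension equals that of `C(N_𝔭)`. -/
def maximalDimensionalComponents : Set (Set (NilpotentCommutingVariety K c)) :=
  {Z | Z ∈ irreducibleComponents (NilpotentCommutingVariety K c) ∧
    topologicalKrullDim Z = topologicalKrullDim (NilpotentCommutingVariety K c)}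

end

end ParabolicCommuting

namespace ParabolicCommuting

open MvPolynomial

/-! ### Krull dimension of finitely generated algebras -/

section Dimension

/-! Project `C(N_𝔭)` to its first factor. Over an orbit `P.x` lie the pairs `(g x g⁻¹, g w g⁻¹)`
with `g ∈ P` and `w` nilpotent in `𝔭^x`, so this piece should have dimension `dim 𝔭 - dim 𝔭^x + dim
(𝔭^x ∩ N_𝔭)`. Nilpotent matrices are traceless and the identity has trace `n ≠ 0`, so the fibre lies
in a hyperplane of `𝔭^x` and the piece has dimension at most `dim 𝔭 - 1`. If `x` is distinguished,
the fibre is the whole hyperplane: the piece is irreducible and the bound is attained. Otherwise the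
fibre lies in a hypersurface of the hyperplane and another dimension is lost. A single Jordan block
is distinguished for every block structure, so distinguished orbits exist.

If there are finitely many orbits, each irreducible subset lies in the closure of one piece, and
comparing dimensions gives part 1. For part 2, if the dimension were below `dim 𝔭`, the closures
over distinguished orbits would be infinitely many distinct irreducible components of a Noetherian
space.

The dimension count avoids orbit quotients. A `Slice` is `1 + S` with `S` a complement of `𝔭^x` in
`𝔭`; on it Cramer's rule inverts `g ↦ g x g⁻¹` rationally. This yields the upper bound
`ringKrullDim_orbitPairs_le`, the lower bound `le_ringKrullDim_orbitPairs`, and, through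
`exists_conj_of_vanishing`, the fact that distinct orbits give distinct closures. -/

theorem ringKrullDim_le_of_isIntegral (R A : Type*) [CommRing R] [CommRing A] [Algebra R A]
    [Algebra.IsIntegral R A] : ringKrullDim A ≤ ringKrullDim R :=
  Order.krullDim_le_of_strictMono (PrimeSpectrum.comap (algebraMap R A))
    fun _ _ h => Ideal.IsIntegral.comap_lt_comap h

/-- Lying over provides a prime above the bottom of a chain, and going up lifts the rest of the
chain without changing its length. -/
theorem ringKrullDim_le_of_isIntegral_of_injective (R A : Type*) [CommRing R] [CommRing A]
    [IsDomain A] [Algebra R A] [Algebra.IsIntegral R A]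
    (hinj : Function.Injective (algebraMap R A)) : ringKrullDim R ≤ ringKrullDim A := by
  refine iSup_le fun l => ?_
  obtain ⟨Q, hQ, hQl⟩ := Ideal.exists_ideal_over_prime_of_isIntegral_of_isDomain (S := A)
    l.head.asIdeal (by rw [(RingHom.injective_iff_ker_eq_bot _).1 hinj]; exact bot_le)
  have : Q.LiesOver l.head.asIdeal := ⟨hQl.symm⟩
  obtain ⟨L, hL, -⟩ := Ideal.exists_ltSeries_of_hasGoingUp l Q
  rw [← hL]
  exact Order.LTSeries.length_le_krullDim L

theorem ringKrullDim_mvPolynomial_field (K ι : Type*) [Field K] [Fintype ι] :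
    ringKrullDim (MvPolynomial ι K) = Fintype.card ι := by
  rw [ringKrullDim_of_isNoetherianRing, ringKrullDim_eq_zero_of_field, Nat.card_eq_fintype_card,
    zero_add]

/-- A finitely generated algebra of Krull dimension `s` contains `s` algebraically independent
elements. -/
theorem exists_algebraicIndependent_ringKrullDim_le (K A : Type*) [Field K] [CommRing A]
    [Nontrivial A] [Algebra K A] [Algebra.FiniteType K A] :
    ∃ (s : ℕ) (a : Fin s → A), AlgebraicIndependent K a ∧ ringKrullDim A ≤ s := by
  obtain ⟨s, g, hg, hint⟩ := exists_integral_inj_algHom_of_fg K A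
  refine ⟨s, fun i => g (X i), ?_, ?_⟩
  · exact (MvPolynomial.algebraicIndependent_X (Fin s) K).map' hg
  · let _ : Algebra (MvPolynomial (Fin s) K) A := g.toRingHom.toAlgebra
    have : Algebra.IsIntegral (MvPolynomial (Fin s) K) A := ⟨hint⟩
    refine (ringKrullDim_le_of_isIntegral (MvPolynomial (Fin s) K) A).trans ?_
    simp

/-- By Noether normalization `A` is integral over a polynomial ring in `s` variables; then `s`
bounds the transcendence degree from above and the Krull dimension from below. -/
theorem card_le_ringKrullDim_of_isDomain {K A ι : Type*} [Field K] [CommRing A] [IsDomain A]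
    [Algebra K A] [Algebra.FiniteType K A] [Fintype ι] {a : ι → A}
    (ha : AlgebraicIndependent K a) : (Fintype.card ι : WithBot ℕ∞) ≤ ringKrullDim A := by
  obtain ⟨s, g, hg, hint⟩ := exists_integral_inj_algHom_of_fg K A
  let _ : Algebra (MvPolynomial (Fin s) K) A := g.toRingHom.toAlgebra
  have : Algebra.IsIntegral (MvPolynomial (Fin s) K) A := ⟨hint⟩
  have h1 := ringKrullDim_le_of_isIntegral_of_injective (MvPolynomial (Fin s) K) A hg
  rw [ringKrullDim_mvPolynomial_field, Fintype.card_fin] at h1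
  refine le_trans ?_ h1
  have hrange : Algebra.adjoin K (Set.range fun i => g (X i)) = g.range := by
    rw [Set.range_comp' g X, ← AlgHom.map_adjoin, MvPolynomial.adjoin_range_X, Algebra.map_top]
  have halg : Algebra.IsAlgebraic (Algebra.adjoin K (Set.range fun i => g (X i))) A := by
    have : Algebra.IsIntegral (Algebra.adjoin K (Set.range fun i => g (X i))) A := by
      refine ⟨fun x => ?_⟩
      obtain ⟨p, hp, hpx⟩ := hint x
      let f : MvPolynomial (Fin s) K →+* Algebra.adjoin K (Set.range fun i => g (X i)) :=
        g.toRingHom.codRestrict _ fun y => by rw [hrange]; exact ⟨y, rfl⟩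
      refine ⟨p.map f, hp.map f, ?_⟩
      rw [Polynomial.eval₂_map]
      exact hpx
    infer_instance
  have h2 := Algebra.IsAlgebraic.trdeg_le_cardinalMk K (A := A) (Set.range fun i => g (X i))
  have h3 : Cardinal.mk (Set.range fun i => g (X i)) ≤ s := by
    simpa using Cardinal.mk_range_le_lift (f := fun i => g (X i))
  have h4 := ha.lift_cardinalMk_le_trdeg.trans (Cardinal.lift_le.2 (h2.trans h3))
  simp only [Cardinal.mk_fintype, Cardinal.lift_natCast, Nat.cast_le] at h4
  exact_mod_cast h4

/-- The number of algebraically independent elements is a lower bound for the Krull dimension. -/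
theorem card_le_ringKrullDim {K A ι : Type*} [Field K] [CommRing A]
    [Algebra K A] [Algebra.FiniteType K A] [Fintype ι] {a : ι → A}
    (ha : AlgebraicIndependent K a) : (Fintype.card ι : WithBot ℕ∞) ≤ ringKrullDim A := by
  -- Some prime `Q` of `A` contracts to zero in the polynomial ring, so the elements stay
  -- independent in the domain `A ⧸ Q`.
  have hmin : (⊥ : Ideal (MvPolynomial ι K)) ∈ minimalPrimes (MvPolynomial ι K) := by
    rw [IsDomain.minimalPrimes_eq_singleton_bot]; rfl
  obtain ⟨Q, hQ, hQc⟩ := Ideal.exists_comap_eq_of_mem_minimalPrimes_of_injective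
    (f := (aeval a : MvPolynomial ι K →ₐ[K] A).toRingHom) ha _ hmin
  have hb : AlgebraicIndependent K (Ideal.Quotient.mkₐ K Q ∘ a) := by
    rw [algebraicIndependent_iff]
    intro p hp
    rw [Function.comp_def, ← comp_aeval_apply, Ideal.Quotient.mkₐ_eq_mk,
      Ideal.Quotient.eq_zero_iff_mem] at hp
    have : p ∈ Ideal.comap (aeval a : MvPolynomial ι K →ₐ[K] A).toRingHom Q := hp
    rwa [hQc] at this
  exact (card_le_ringKrullDim_of_isDomain hb).trans (ringKrullDim_quotient_le Q)

/-- A prime of the localization is the extension of its contraction, so contracting preserves strict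
inclusions. -/
theorem ringKrullDim_localizationAway_le {R : Type*} [CommRing R] (r : R) :
    ringKrullDim (Localization.Away r) ≤ ringKrullDim R := by
  refine Order.krullDim_le_of_strictMono
    (PrimeSpectrum.comap (algebraMap R (Localization.Away r))) ?_
  intro I J h
  refine lt_of_le_not_ge (Ideal.comap_mono h.le) fun h' => h.not_ge ?_
  have h2 : Ideal.comap (algebraMap R (Localization.Away r)) J.asIdeal ≤
    Ideal.comap (algebraMap R (Localization.Away r)) I.asIdeal := h'
  have := Ideal.map_mono (f := algebraMap R (Localization.Away r)) h2
  rwa [IsLocalization.map_under (Submonoid.powers r), IsLocalization.map_under (Submonoid.powers r)]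
    at this

/-- One nontrivial equation costs a dimension; this is the source of the extra drop over orbits that
are not distinguished. -/
theorem ringKrullDim_quotient_succ_le {K τ : Type*} [Field K] [Fintype τ]
    {I : Ideal (MvPolynomial τ K)} {f : MvPolynomial τ K} (hf : f ≠ 0) (hfI : f ∈ I) :
    ringKrullDim (MvPolynomial τ K ⧸ I) + 1 ≤ Fintype.card τ := by
  rw [← ringKrullDim_mvPolynomial_field K τ]
  exact ringKrullDim_succ_le_of_surjective _ Ideal.Quotient.mk_surjective
    (mem_nonZeroDivisors_of_ne_zero hf) (Ideal.Quotient.eq_zero_iff_mem.2 hfI)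

end Dimension

/-! ### Rational maps: dimension bounds and irreducibility of images -/

section RationalMaps

variable {K σ τ : Type*} [Field K]

/-- Evaluation at a point `z` of `T` with `q z ≠ 0`, on the localization at `q` of the
coordinate ring. -/
theorem exists_evalAway (I : Ideal (MvPolynomial σ K)) (q : MvPolynomial σ K) (z : σ → K)
    (hz : z ∈ zeroLocus K I) (hq : aeval z q ≠ 0) :
    ∃ ev : Localization.Away (Ideal.Quotient.mk I q) →ₐ[K] K,
      ∀ p, ev (algebraMap _ _ (Ideal.Quotient.mk I p)) = aeval z p := by
  let e0 : (MvPolynomial σ K ⧸ I) →ₐ[K] K := Ideal.Quotient.liftₐ I (aeval z) hz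
  have hu : ∀ y : Submonoid.powers (Ideal.Quotient.mk I q), IsUnit (e0 y) := by
    rintro ⟨_, k, rfl⟩
    have h0 : e0 (Ideal.Quotient.mk I q) = aeval z q := rfl
    simp only [map_pow, h0]
    exact (IsUnit.mk0 _ hq).pow k
  refine ⟨IsLocalization.liftAlgHom (M := Submonoid.powers (Ideal.Quotient.mk I q)) hu, ?_⟩
  intro p
  rw [IsLocalization.liftAlgHom_apply, IsLocalization.lift_eq]
  rfl

/-- A dominant rational map `ρ / q` from `T` to the affine space `τ → K` bounds the dimension of
`T` from below. -/
theorem card_le_ringKrullDim_of_dominant [Finite σ] [Fintype τ] [Infinite K]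
    {T : Set (σ → K)} (q : MvPolynomial σ K)
    (ρ : τ → MvPolynomial σ K) {h : MvPolynomial τ K} (hh : h ≠ 0)
    (hdom : ∀ u : τ → K, aeval u h ≠ 0 →
      ∃ z ∈ T, aeval z q ≠ 0 ∧ ∀ i, aeval z (ρ i) = aeval z q * u i) :
    (Fintype.card τ : WithBot ℕ∞) ≤ ringKrullDim (MvPolynomial σ K ⧸ vanishingIdeal K T) := by
  set I := vanishingIdeal K T
  let R := Localization.Away (Ideal.Quotient.mk I q)
  let φ : MvPolynomial σ K →ₐ[K] R :=
    (IsScalarTower.toAlgHom K (MvPolynomial σ K ⧸ I) R).comp (Ideal.Quotient.mkₐ K I)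
  let qi : R := IsLocalization.Away.invSelf (Ideal.Quotient.mk I q)
  have hqi : φ q * qi = 1 := IsLocalization.Away.mul_invSelf (Ideal.Quotient.mk I q)
  have : Algebra.FiniteType K R :=
    Algebra.FiniteType.trans (S := MvPolynomial σ K ⧸ I) inferInstance
      (IsLocalization.finiteType_of_monoid_fg (Submonoid.powers (Ideal.Quotient.mk I q)) _)
  refine le_trans (card_le_ringKrullDim (K := K) (A := R) (a := fun i => φ (ρ i) * qi) ?_)
    (ringKrullDim_localizationAway_le _)
  rw [algebraicIndependent_iff]
  intro F hF
  -- A relation `F` among the fractions vanishes at every `u` hit by the map, hence wherever `h u ≠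
  -- 0`; over an infinite field the polynomial `F * h` is then zero.
  have hFh : F * h = 0 := by
    refine MvPolynomial.funext fun u => ?_
    rw [map_mul, map_zero, mul_eq_zero, or_iff_not_imp_right]
    intro hu
    obtain ⟨z, hzT, hqz, hρ⟩ := hdom u (by rwa [aeval_eq_eval])
    obtain ⟨ev, hev⟩ := exists_evalAway I q z
      (zeroLocus_vanishingIdeal_le T hzT) hqz
    have hev' : ∀ p, ev (φ p) = aeval z p := hev
    have h1 := congrArg ev hF
    rw [comp_aeval_apply, map_zero] at h1
    have h2 : (fun i => ev (φ (ρ i) * qi)) = u := by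
      funext i
      have h3 := congrArg ev hqi
      rw [map_mul, hev', map_one] at h3
      rw [map_mul, hev', hρ, mul_right_comm, h3, one_mul]
    rwa [h2, aeval_eq_eval] at h1
  exact (mul_eq_zero.1 hFh).resolve_right hh

/-- If the points `φ u / q u` with `u` in the zero locus of `J` and `q u ≠ 0` are dense in `T`,
then the dimension of `T` is at most that of the zero locus of `J`. -/
theorem ringKrullDim_le_of_parametrization [Finite σ] [Finite τ] {T : Set (σ → K)}
    (J : Ideal (MvPolynomial τ K))
    (q : MvPolynomial τ K) (φ : σ → MvPolynomial τ K)
    (hdense : ∀ p : MvPolynomial σ K, (∀ (z : σ → K) (u : τ → K), u ∈ zeroLocus K J →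
      aeval u q ≠ 0 → (∀ i, aeval u (φ i) = aeval u q * z i) → aeval z p = 0) →
        ∀ z ∈ T, aeval z p = 0) :
    ringKrullDim (MvPolynomial σ K ⧸ vanishingIdeal K T) ≤ ringKrullDim (MvPolynomial τ K ⧸ J) := by
  set I := vanishingIdeal K T with hI
  rcases subsingleton_or_nontrivial (MvPolynomial σ K ⧸ I) with hs | hn
  · rw [ringKrullDim_eq_bot_of_subsingleton]; exact bot_le
  obtain ⟨s, a, ha, hle⟩ := exists_algebraicIndependent_ringKrullDim_le K (MvPolynomial σ K ⧸ I)
  refine hle.trans ?_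
  let R := Localization.Away (Ideal.Quotient.mk J q)
  let ψ : MvPolynomial τ K →ₐ[K] R :=
    (IsScalarTower.toAlgHom K (MvPolynomial τ K ⧸ J) R).comp (Ideal.Quotient.mkₐ K J)
  let qi : R := IsLocalization.Away.invSelf (Ideal.Quotient.mk J q)
  have hqi : ψ q * qi = 1 := IsLocalization.Away.mul_invSelf (Ideal.Quotient.mk J q)
  have : Algebra.FiniteType K R :=
    Algebra.FiniteType.trans (S := MvPolynomial τ K ⧸ J) inferInstance
      (IsLocalization.finiteType_of_monoid_fg (Submonoid.powers (Ideal.Quotient.mk J q)) _)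
  choose b hb using fun i => Ideal.Quotient.mk_surjective (a i)
  let θ : MvPolynomial σ K →ₐ[K] R := aeval fun i => ψ (φ i) * qi
  -- Density makes the pullback `θ` injective modulo `I`, so independent elements of the coordinate
  -- ring of `T` remain independent in `R`.
  have key : ∀ p, θ p = 0 → p ∈ I := by
    intro p hp
    rw [hI, mem_vanishingIdeal_iff]
    refine hdense p fun z u hu hqu hz => ?_
    obtain ⟨ev, hev⟩ := exists_evalAway J q u hu hqu
    have hev' : ∀ p, ev (ψ p) = aeval u p := hev
    have h1 := congrArg ev hp
    simp only [θ] at h1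
    rw [comp_aeval_apply, map_zero] at h1
    have h2 : (fun i => ev (ψ (φ i) * qi)) = z := by
      funext i
      have h3 := congrArg ev hqi
      rw [map_mul, hev', map_one] at h3
      rw [map_mul, hev', hz, mul_right_comm, h3, one_mul]
    rwa [h2] at h1
  have hind : AlgebraicIndependent K (fun i => θ (b i)) := by
    rw [algebraicIndependent_iff]
    intro F hF
    have h1 : θ (aeval b F) = 0 := by rw [comp_aeval_apply]; exact hF
    have h2 := key _ h1
    rw [← Ideal.Quotient.eq_zero_iff_mem] at h2
    refine (algebraicIndependent_iff.1 ha) F ?_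
    rw [← h2, ← Ideal.Quotient.mkₐ_eq_mk K, comp_aeval_apply]
    simp only [Ideal.Quotient.mkₐ_eq_mk, hb]
  have := (card_le_ringKrullDim hind).trans (ringKrullDim_localizationAway_le _)
  simpa using this

/-- Clearing denominators in `p (φ / q)`. -/
theorem exists_clear_denominators (q : MvPolynomial τ K) (φ : σ → MvPolynomial τ K)
    (p : MvPolynomial σ K) : ∃ (P : MvPolynomial τ K) (N : ℕ), ∀ (u : τ → K) (z : σ → K),
      (∀ i, aeval u (φ i) = aeval u q * z i) → aeval u P = aeval u q ^ N * aeval z p := by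
  induction p using MvPolynomial.induction_on with
  | C a => exact ⟨C a, 0, fun u z _ => by simp⟩
  | add p₁ p₂ h₁ h₂ =>
    obtain ⟨P₁, N₁, h₁⟩ := h₁
    obtain ⟨P₂, N₂, h₂⟩ := h₂
    refine ⟨q ^ N₂ * P₁ + q ^ N₁ * P₂, N₁ + N₂, fun u z hz => ?_⟩
    simp only [map_add, map_mul, map_pow, h₁ u z hz, h₂ u z hz]
    ring
  | mul_X p i h =>
    obtain ⟨P, N, h⟩ := h
    refine ⟨P * φ i, N + 1, fun u z hz => ?_⟩
    simp only [map_mul, h u z hz, hz, aeval_X]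
    ring

/-- The image of a rational map on an affine space is irreducible. -/
theorem isPrime_vanishingIdeal_of_parametrization [Infinite K] {T : Set (σ → K)}
    (q : MvPolynomial τ K) (hq : q ≠ 0) (φ : σ → MvPolynomial τ K)
    (hT : ∀ z, z ∈ T ↔ ∃ u : τ → K, aeval u q ≠ 0 ∧ ∀ i, aeval u (φ i) = aeval u q * z i) :
    (vanishingIdeal K T).IsPrime := by
  -- Vanishing on `T` is vanishing of the numerator off the hypersurface `q = 0`. Quantifying over
  -- all numerators lets the product of two numerators serve for a product of polynomials.
  have key : ∀ p, p ∈ vanishingIdeal K T ↔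
      ∀ P N, (∀ (u : τ → K) (z : σ → K), (∀ i, aeval u (φ i) = aeval u q * z i) →
        aeval u P = aeval u q ^ N * aeval z p) → P * q = 0 := by
    intro p
    constructor
    · intro hp P N hP
      refine MvPolynomial.funext fun u => ?_
      rw [map_mul, map_zero, mul_eq_zero, or_iff_not_imp_right]
      intro hu
      have hu' : aeval u q ≠ 0 := by rwa [aeval_eq_eval]
      have hz : ∀ i, aeval u (φ i) = aeval u q * (aeval u (φ i) / aeval u q) := fun i => by
        field_simp
      have h1 := hP u (fun i => aeval u (φ i) / aeval u q) hz
      rw [(mem_vanishingIdeal_iff.1 hp) _ ((hT _).2 ⟨u, hu', hz⟩), mul_zero] at h1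
      rwa [aeval_eq_eval] at h1
    · intro h
      obtain ⟨P, N, hP⟩ := exists_clear_denominators q φ p
      have hP0 : P = 0 := (mul_eq_zero.1 (h P N hP)).resolve_right hq
      rw [mem_vanishingIdeal_iff]
      intro z hz
      obtain ⟨u, hu, huz⟩ := (hT z).1 hz
      have := hP u z huz
      rw [hP0, map_zero, eq_comm, mul_eq_zero] at this
      exact this.resolve_left (pow_ne_zero _ hu)
  refine ⟨?_, ?_⟩
  · rw [Ideal.ne_top_iff_one]
    intro h1
    have := (key 1).1 h1 1 0 (by simp)
    exact hq (by simpa using this)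
  · intro p₁ p₂ h
    obtain ⟨P₁, N₁, h₁⟩ := exists_clear_denominators q φ p₁
    obtain ⟨P₂, N₂, h₂⟩ := exists_clear_denominators q φ p₂
    have h12 := (key (p₁ * p₂)).1 h (P₁ * P₂) (N₁ + N₂) fun u z hz => by
      simp only [map_mul, h₁ u z hz, h₂ u z hz]; ring
    have aux : ∀ {p : MvPolynomial σ K} {P : MvPolynomial τ K} {N : ℕ}, P = 0 →
        (∀ (u : τ → K) (z : σ → K), (∀ i, aeval u (φ i) = aeval u q * z i) →
          aeval u P = aeval u q ^ N * aeval z p) →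
        p ∈ vanishingIdeal K T := by
      intro p P N hP h
      rw [mem_vanishingIdeal_iff]
      intro z hz
      obtain ⟨u, hu, huz⟩ := (hT z).1 hz
      have := h u z huz
      rw [hP, map_zero, eq_comm, mul_eq_zero] at this
      exact this.resolve_left (pow_ne_zero _ hu)
    rcases mul_eq_zero.1 ((mul_eq_zero.1 h12).resolve_right hq) with h0 | h0
    · exact Or.inl (aux h0 h₁)
    · exact Or.inr (aux h0 h₂)

end RationalMaps

/-! ### Zariski closed subspaces of affine space -/

section Topology

variable {K σ X : Type*} [Field K] [TopologicalSpace X] {e : X → σ → K}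

/-- Hypothesis `he` says that `X` carries the topology pulled back along `e`. Stated this way, the
result covers both the variety and its subspaces. -/
theorem isIrreducible_iff_isPrime_vanishingIdeal
    (he : ∀ Z : Set X, IsClosed Z ↔ ∃ I : Ideal (MvPolynomial σ K), Z = e ⁻¹' zeroLocus K I)
    (A : Set X) : IsIrreducible A ↔ (vanishingIdeal K (e '' A)).IsPrime := by
  constructor
  · rintro ⟨⟨a, ha⟩, hA⟩
    refine ⟨?_, ?_⟩
    · rw [Ideal.ne_top_iff_one, mem_vanishingIdeal_iff]
      intro h
      simpa using h _ ⟨a, ha, rfl⟩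
    · intro p₁ p₂ h
      have hcl : ∀ p : MvPolynomial σ K, IsClosed (e ⁻¹' zeroLocus K (Ideal.span {p})) :=
        fun p => (he _).2 ⟨_, rfl⟩
      have hmem : ∀ (p : MvPolynomial σ K) (x : X),
          x ∈ e ⁻¹' zeroLocus K (Ideal.span {p}) ↔ aeval (e x) p = 0 := by
        intro p x
        simp [zeroLocus_span]
      have := isPreirreducible_iff_isClosed_union_isClosed.1 hA _ _ (hcl p₁) (hcl p₂) (by
        intro x hx
        have h1 := (mem_vanishingIdeal_iff.1 h) _ ⟨x, hx, rfl⟩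
        rw [map_mul, mul_eq_zero] at h1
        rcases h1 with h1 | h1
        · exact Or.inl ((hmem _ _).2 h1)
        · exact Or.inr ((hmem _ _).2 h1))
      simp only [mem_vanishingIdeal_iff, Set.forall_mem_image]
      rcases this with h1 | h1
      · exact Or.inl fun x hx => (hmem _ _).1 (h1 hx)
      · exact Or.inr fun x hx => (hmem _ _).1 (h1 hx)
  · intro hp
    refine ⟨?_, ?_⟩
    · by_contra hne
      rw [Set.not_nonempty_iff_eq_empty] at hne
      apply hp.ne_top
      rw [hne, Set.image_empty, vanishingIdeal_empty]
    · rw [isPreirreducible_iff_isClosed_union_isClosed]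
      intro Z₁ Z₂ h₁ h₂ hA
      obtain ⟨I₁, rfl⟩ := (he _).1 h₁
      obtain ⟨I₂, rfl⟩ := (he _).1 h₂
      have h12 : I₁ * I₂ ≤ vanishingIdeal K (e '' A) := by
        rw [Ideal.mul_le]
        intro p₁ hp₁ p₂ hp₂
        rw [mem_vanishingIdeal_iff]
        rintro _ ⟨x, hx, rfl⟩
        rw [map_mul]
        rcases hA hx with h | h
        · rw [h p₁ hp₁, zero_mul]
        · rw [h p₂ hp₂, mul_zero]
      rcases (Ideal.IsPrime.mul_le hp).1 h12 with h | h
      · exact Or.inl fun x hx p hp => mem_vanishingIdeal_iff.1 (h hp) _ ⟨x, hx, rfl⟩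
      · exact Or.inr fun x hx p hp => mem_vanishingIdeal_iff.1 (h hp) _ ⟨x, hx, rfl⟩

theorem mem_closure_iff_vanishingIdeal
    (he : ∀ Z : Set X, IsClosed Z ↔ ∃ I : Ideal (MvPolynomial σ K), Z = e ⁻¹' zeroLocus K I)
    (A : Set X) (x : X) :
    x ∈ closure A ↔ ∀ p : MvPolynomial σ K, (∀ a ∈ A, aeval (e a) p = 0) → aeval (e x) p = 0 := by
  constructor
  · intro hx p hp
    have h1 : A ⊆ e ⁻¹' zeroLocus K (vanishingIdeal K (e '' A)) := fun a ha =>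
      zeroLocus_vanishingIdeal_le (e '' A) (Set.mem_image_of_mem e ha)
    exact closure_minimal h1 ((he _).2 ⟨_, rfl⟩) hx p
      (mem_vanishingIdeal_iff.2 (Set.forall_mem_image.2 hp))
  · intro h
    obtain ⟨I, hI⟩ := (he _).1 (isClosed_closure (s := A))
    rw [hI]
    intro p hp
    refine h p fun a ha => ?_
    have : a ∈ e ⁻¹' zeroLocus K I := hI ▸ subset_closure ha
    exact this p hp

theorem eq_of_vanishingIdeal_eq
    (he : ∀ Z : Set X, IsClosed Z ↔ ∃ I : Ideal (MvPolynomial σ K), Z = e ⁻¹' zeroLocus K I)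
    {A B : Set X} (hA : IsClosed A) (hB : IsClosed B)
    (h : vanishingIdeal K (e '' A) = vanishingIdeal K (e '' B)) : A = B := by
  rw [← hA.closure_eq, ← hB.closure_eq]
  ext x
  simp only [mem_closure_iff_vanishingIdeal he]
  have := fun p => SetLike.ext_iff.1 h p
  simp only [mem_vanishingIdeal_iff, Set.forall_mem_image] at this
  exact forall_congr' fun p => imp_congr (this p) Iff.rfl

/-- Irreducible closed sets and primes over the vanishing ideal correspond with order reversed. The
Nullstellensatz recovers a prime from its zero locus, and `hr` keeps that zero locus inside the
range of `e`. -/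
theorem topologicalKrullDim_eq_ringKrullDim [IsAlgClosed K] [Finite σ]
    (he : ∀ Z : Set X, IsClosed Z ↔ ∃ I : Ideal (MvPolynomial σ K), Z = e ⁻¹' zeroLocus K I)
    (hr : ∃ I : Ideal (MvPolynomial σ K), Set.range e = zeroLocus K I) :
    topologicalKrullDim X =
      ringKrullDim (MvPolynomial σ K ⧸ vanishingIdeal K (Set.range e)) := by
  have hcl : zeroLocus K (vanishingIdeal K (Set.range e)) = Set.range e := by
    obtain ⟨I, hI⟩ := hr
    rw [hI]
    refine Set.Subset.antisymm (zeroLocus_anti_mono ?_) (zeroLocus_vanishingIdeal_le _)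
    exact le_vanishingIdeal_zeroLocus I
  rw [ringKrullDim_quotient, ← Order.krullDim_orderDual]
  refine le_antisymm ?_ ?_
  · refine Order.krullDim_le_of_strictMono (fun A => OrderDual.toDual
      ⟨⟨vanishingIdeal K (e '' A), (isIrreducible_iff_isPrime_vanishingIdeal he _).1
        A.isIrreducible⟩, vanishingIdeal_anti_mono (Set.image_subset_range _ _)⟩) ?_
    refine Monotone.strictMono_of_injective ?_ ?_
    · intro A B hAB
      exact vanishingIdeal_anti_mono (Set.image_mono hAB)
    · intro A B hAB
      have h : vanishingIdeal K (e '' (A : Set X)) = vanishingIdeal K (e '' (B : Set X)) :=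
        congrArg (fun z => (OrderDual.ofDual z).1.asIdeal) hAB
      exact TopologicalSpace.IrreducibleCloseds.ext
        (eq_of_vanishingIdeal_eq he A.isClosed B.isClosed h)
  · have him : ∀ Q : (PrimeSpectrum.zeroLocus
        (vanishingIdeal K (Set.range e) : Set (MvPolynomial σ K)))ᵒᵈ,
        e '' (e ⁻¹' zeroLocus K (OrderDual.ofDual Q).1.asIdeal) =
          zeroLocus K (OrderDual.ofDual Q).1.asIdeal := by
      intro Q
      rw [Set.image_preimage_eq_inter_range, Set.inter_eq_left]
      exact (zeroLocus_anti_mono (OrderDual.ofDual Q).2).trans hcl.subset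
    refine Order.krullDim_le_of_strictMono (fun Q =>
      ⟨e ⁻¹' zeroLocus K (OrderDual.ofDual Q).1.asIdeal, ?_, (he _).2 ⟨_, rfl⟩⟩) ?_
    · rw [isIrreducible_iff_isPrime_vanishingIdeal he, him,
        MvPolynomial.IsPrime.vanishingIdeal_zeroLocus]
      infer_instance
    · refine Monotone.strictMono_of_injective ?_ ?_
      · intro Q Q' h
        have h' : (OrderDual.ofDual Q').1.asIdeal ≤ (OrderDual.ofDual Q).1.asIdeal := h
        exact fun x hx p hp => hx p (h' hp)
      · intro Q Q' h
        have h' : e ⁻¹' zeroLocus K (OrderDual.ofDual Q).1.asIdeal =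
            e ⁻¹' zeroLocus K (OrderDual.ofDual Q').1.asIdeal :=
          congrArg (fun Z : TopologicalSpace.IrreducibleCloseds X => (Z : Set X)) h
        have h2 := congrArg (fun Z => vanishingIdeal K (e '' Z)) h'
        simp only [him, MvPolynomial.IsPrime.vanishingIdeal_zeroLocus] at h2
        exact OrderDual.ofDual.injective (Subtype.ext (PrimeSpectrum.ext h2))

/-- Hilbert's basis theorem: strictly descending closed sets have strictly ascending vanishing
ideals. -/
theorem noetherianSpace_of_isClosed_iff [Finite σ]
    (he : ∀ Z : Set X, IsClosed Z ↔ ∃ I : Ideal (MvPolynomial σ K), Z = e ⁻¹' zeroLocus K I) :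
    TopologicalSpace.NoetherianSpace X := by
  have h01 : TopologicalSpace.NoetherianSpace X ↔ WellFoundedLT (TopologicalSpace.Closeds X) :=
    (TopologicalSpace.noetherianSpace_TFAE X).out 0 1
  refine h01.2 ?_
  refine StrictMono.wellFoundedLT (β := (Ideal (MvPolynomial σ K))ᵒᵈ)
    (f := fun Z => OrderDual.toDual (vanishingIdeal K (e '' Z))) ?_
  refine Monotone.strictMono_of_injective
    (fun A B hAB => vanishingIdeal_anti_mono (Set.image_mono hAB)) fun A B hAB => ?_
  exact TopologicalSpace.Closeds.ext (eq_of_vanishingIdeal_eq he A.isClosed B.isClosed hAB)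

end Topology

/-! ### Polynomial functions and matrices of polynomial functions -/

section PolyFun

variable {K τ : Type*} [Field K]

/-- A function on the affine space `τ → K` that is given by a polynomial. -/
def IsPolyFun (f : (τ → K) → K) : Prop :=
  ∃ p : MvPolynomial τ K, ∀ u, aeval u p = f u

/-- A matrix valued function on `τ → K` all of whose entries are polynomial. -/
def IsPolyMat {l m : Type*} (Y : (τ → K) → Matrix l m K) : Prop :=
  ∀ i j, IsPolyFun fun u => Y u i j

namespace IsPolyFun

theorem const (a : K) : IsPolyFun fun _ : τ → K => a := ⟨C a, by simp⟩

theorem coord (i : τ) : IsPolyFun fun u : τ → K => u i := ⟨X i, by simp⟩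

variable {f g : (τ → K) → K}

theorem add (hf : IsPolyFun f) (hg : IsPolyFun g) : IsPolyFun fun u => f u + g u := by
  obtain ⟨p, hp⟩ := hf
  obtain ⟨q, hq⟩ := hg
  exact ⟨p + q, fun u => by rw [map_add, hp, hq]⟩

theorem mul (hf : IsPolyFun f) (hg : IsPolyFun g) : IsPolyFun fun u => f u * g u := by
  obtain ⟨p, hp⟩ := hf
  obtain ⟨q, hq⟩ := hg
  exact ⟨p * q, fun u => by rw [map_mul, hp, hq]⟩

theorem sub (hf : IsPolyFun f) (hg : IsPolyFun g) : IsPolyFun fun u => f u - g u := by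
  obtain ⟨p, hp⟩ := hf
  obtain ⟨q, hq⟩ := hg
  exact ⟨p - q, fun u => by rw [map_sub, hp, hq]⟩

theorem sum {ι : Type*} (s : Finset ι) {F : ι → (τ → K) → K} (hF : ∀ i, IsPolyFun (F i)) :
    IsPolyFun fun u => ∑ i ∈ s, F i u := by
  choose p hp using hF
  exact ⟨∑ i ∈ s, p i, fun u => by simp only [map_sum, hp]⟩

theorem prod {ι : Type*} (s : Finset ι) {F : ι → (τ → K) → K} (hF : ∀ i, IsPolyFun (F i)) :
    IsPolyFun fun u => ∏ i ∈ s, F i u := by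
  choose p hp using hF
  exact ⟨∏ i ∈ s, p i, fun u => by simp only [map_prod, hp]⟩

end IsPolyFun

namespace IsPolyMat

variable {k l m ι : Type*}

theorem const (A : Matrix l m K) : IsPolyMat fun _ : τ → K => A :=
  fun i j => IsPolyFun.const (A i j)

theorem add {Y Z : (τ → K) → Matrix l m K} (hY : IsPolyMat Y) (hZ : IsPolyMat Z) :
    IsPolyMat fun u => Y u + Z u :=
  fun i j => (hY i j).add (hZ i j)

theorem sub {Y Z : (τ → K) → Matrix l m K} (hY : IsPolyMat Y) (hZ : IsPolyMat Z) :
    IsPolyMat fun u => Y u - Z u :=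
  fun i j => (hY i j).sub (hZ i j)

theorem smul {f : (τ → K) → K} {Y : (τ → K) → Matrix l m K} (hf : IsPolyFun f)
    (hY : IsPolyMat Y) : IsPolyMat fun u => f u • Y u :=
  fun i j => hf.mul (hY i j)

theorem mul [Fintype l] {Y : (τ → K) → Matrix k l K} {Z : (τ → K) → Matrix l m K} (hY : IsPolyMat Y)
    (hZ : IsPolyMat Z) : IsPolyMat fun u => Y u * Z u :=
  fun i j => IsPolyFun.sum Finset.univ fun t => (hY i t).mul (hZ t j)

theorem sum [Fintype ι] {Y : ι → (τ → K) → Matrix l m K} (hY : ∀ i, IsPolyMat (Y i)) :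
    IsPolyMat fun u => ∑ i, Y i u := by
  intro a b
  simpa only [Matrix.sum_apply] using IsPolyFun.sum Finset.univ fun i => hY i a b

theorem det [Fintype l] [DecidableEq l] {Y : (τ → K) → Matrix l l K} (hY : IsPolyMat Y) :
    IsPolyFun fun u => (Y u).det := by
  simp only [Matrix.det_apply']
  exact IsPolyFun.sum Finset.univ fun s => (IsPolyFun.const _).mul
    (IsPolyFun.prod Finset.univ fun i => hY _ _)

theorem adjugate [Fintype l] [DecidableEq l] {Y : (τ → K) → Matrix l l K} (hY : IsPolyMat Y) :
    IsPolyMat fun u => (Y u).adjugate := by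
  intro i j
  simp only [Matrix.adjugate_apply]
  refine det fun a b => ?_
  by_cases h : a = j
  · simp only [Matrix.updateRow_apply, h, if_true]
    exact IsPolyFun.const _
  · simp only [Matrix.updateRow_apply, h, if_false]
    exact hY a b

theorem pow [Fintype l] [DecidableEq l] {Y : (τ → K) → Matrix l l K} (hY : IsPolyMat Y) (N : ℕ) :
    IsPolyMat fun u => Y u ^ N := by
  induction N with
  | zero => simpa only [pow_zero] using const 1
  | succ N ih => simpa only [pow_succ] using ih.mul hY

theorem linear [Fintype l] [Fintype m] [DecidableEq l] [DecidableEq m]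
    {Y : (τ → K) → Matrix l m K} (hY : IsPolyMat Y) (f : Matrix l m K →ₗ[K] K) :
    IsPolyFun fun u => f (Y u) := by
  have h : ∀ A : Matrix l m K, f A = ∑ i, ∑ j, A i j * f (Matrix.single i j 1) := by
    intro A
    conv_lhs => rw [Matrix.matrix_eq_sum_single A]
    simp only [map_sum]
    refine Finset.sum_congr rfl fun i _ => Finset.sum_congr rfl fun j _ => ?_
    rw [← smul_eq_mul, ← map_smul, Matrix.smul_single, smul_eq_mul, mul_one]
  simp only [fun u => h (Y u)]
  exact IsPolyFun.sum _ fun i => IsPolyFun.sum _ fun j => (hY i j).mul (IsPolyFun.const _)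

theorem linearCombination [Fintype ι] (e : ι → τ) (b : ι → Matrix l m K) :
    IsPolyMat fun u : τ → K => ∑ i, u (e i) • b i :=
  sum fun i => (const (b i)).smul (IsPolyFun.coord (e i))

end IsPolyMat

end PolyFun

/-! ### Pairs of matrices as points of an affine space -/

section Pairs

variable {K : Type*} {n : ℕ}

/-- The index set of the coordinates of a pair of `n × n` matrices. -/
abbrev PairIndex (n : ℕ) : Type := (Fin n × Fin n) ⊕ (Fin n × Fin n)

/-- The first matrix of a point of the space of pairs. -/
def fstMat (u : PairIndex n → K) : Matrix (Fin n) (Fin n) K :=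
  Matrix.of fun i j => u (Sum.inl (i, j))

/-- The second matrix of a point of the space of pairs. -/
def sndMat (u : PairIndex n → K) : Matrix (Fin n) (Fin n) K :=
  Matrix.of fun i j => u (Sum.inr (i, j))

@[simp]
theorem fstMat_pairCoordinates (z : Matrix (Fin n) (Fin n) K × Matrix (Fin n) (Fin n) K) :
    fstMat (pairCoordinates z) = z.1 := rfl

@[simp]
theorem sndMat_pairCoordinates (z : Matrix (Fin n) (Fin n) K × Matrix (Fin n) (Fin n) K) :
    sndMat (pairCoordinates z) = z.2 := rfl

theorem pairCoordinates_fstMat_sndMat (u : PairIndex n → K) :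
    pairCoordinates (fstMat u, sndMat u) = u := by
  funext i
  rcases i with i | i <;> rfl

variable [Field K]

theorem isPolyMat_fstMat : IsPolyMat (fstMat : (PairIndex n → K) → _) :=
  fun _ _ => IsPolyFun.coord _

theorem isPolyMat_sndMat : IsPolyMat (sndMat : (PairIndex n → K) → _) :=
  fun _ _ => IsPolyFun.coord _

/-- Conjugation rewritten with the adjugate, so that its entries are polynomials over the single
denominator `det g`. -/
theorem mul_eq_mul_iff_smul {g x y : Matrix (Fin n) (Fin n) K} (hg : g.det ≠ 0) :
    y * g = g * x ↔ g * x * g.adjugate = g.det • y := by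
  constructor
  · intro h
    rw [← h, mul_assoc, Matrix.mul_adjugate, mul_smul_comm, mul_one]
  · intro h
    have h1 := congrArg (· * g) h
    simp only [mul_assoc, Matrix.adjugate_mul, mul_smul_comm, mul_one, smul_mul_assoc] at h1
    exact ((smul_right_injective _ hg) h1).symm

theorem inv_mul_eq_mul_inv {g y v : Matrix (Fin n) (Fin n) K} (hg : g.det ≠ 0)
    (h : y * g = g * v) : g⁻¹ * y = v * g⁻¹ := by
  have hu : IsUnit g.det := IsUnit.mk0 _ hg
  have h3 := congrArg (fun m => g⁻¹ * m * g⁻¹) h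
  simp only [mul_assoc, Matrix.mul_nonsing_inv _ hu, mul_one] at h3
  rw [h3, ← mul_assoc g⁻¹ g, Matrix.nonsing_inv_mul _ hu, one_mul]

/-- The polynomials `φ` with `φ / det g` the coordinates of the pair `(g x g⁻¹, g w g⁻¹)`, for
matrices `g` and `w` that depend polynomially on a parameter. -/
theorem exists_conj_polynomials {τ : Type*} (x : Matrix (Fin n) (Fin n) K)
    {g w : (τ → K) → Matrix (Fin n) (Fin n) K} (hg : IsPolyMat g) (hw : IsPolyMat w) :
    ∃ (q : MvPolynomial τ K) (φ : PairIndex n → MvPolynomial τ K),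
      (∀ u, aeval u q = (g u).det) ∧
      ∀ u, (g u).det ≠ 0 → ∀ z : PairIndex n → K,
        (∀ i, aeval u (φ i) = aeval u q * z i) ↔
          fstMat z * g u = g u * x ∧ sndMat z * g u = g u * w u := by
  obtain ⟨q, hq⟩ := hg.det
  choose φ₁ h₁ using (hg.mul (IsPolyMat.const x)).mul hg.adjugate
  choose φ₂ h₂ using (hg.mul hw).mul hg.adjugate
  refine ⟨q, Sum.elim (fun i => φ₁ i.1 i.2) (fun i => φ₂ i.1 i.2), hq, fun u hu z => ?_⟩
  rw [mul_eq_mul_iff_smul hu, mul_eq_mul_iff_smul hu, Sum.forall, Prod.forall, Prod.forall,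
    ← Matrix.ext_iff, ← Matrix.ext_iff]
  simp only [Sum.elim_inl, Sum.elim_inr, h₁, h₂, hq]
  rfl

end Pairs

/-! ### Pairs over an orbit -/

section OrbitPairs

variable {K : Type*} [Field K] {n : ℕ} (c : Composition n)

/-- The pairs `(g x g⁻¹, g w g⁻¹)` with `g ∈ P` and `w ∈ W`. -/
def orbitPairs (x : Matrix (Fin n) (Fin n) K) (W : Set (Matrix (Fin n) (Fin n) K)) :
    Set (PairIndex n → K) :=
  {z | ∃ g ∈ parabolicLie K c, g.det ≠ 0 ∧
    ∃ w ∈ W, fstMat z * g = g * x ∧ sndMat z * g = g * w}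

theorem one_mem_parabolicLie : (1 : Matrix (Fin n) (Fin n) K) ∈ parabolicLie K c :=
  Matrix.blockTriangular_one

theorem mul_mem_parabolicLie {x y : Matrix (Fin n) (Fin n) K} (hx : x ∈ parabolicLie K c)
    (hy : y ∈ parabolicLie K c) : x * y ∈ parabolicLie K c :=
  Matrix.BlockTriangular.mul hx hy

theorem inv_mem_parabolicLie {x : Matrix (Fin n) (Fin n) K} (hx : x ∈ parabolicLie K c)
    (h : x.det ≠ 0) : x⁻¹ ∈ parabolicLie K c := by
  have : Invertible x := x.invertibleOfIsUnitDet (IsUnit.mk0 _ h)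
  exact Matrix.blockTriangular_inv_of_blockTriangular hx

theorem pairCoordinates_mem_orbitPairs (x : Matrix (Fin n) (Fin n) K)
    {W : Set (Matrix (Fin n) (Fin n) K)} {w : Matrix (Fin n) (Fin n) K} (hw : w ∈ W) :
    pairCoordinates (x, w) ∈ orbitPairs c x W :=
  ⟨1, one_mem_parabolicLie c, by simp, w, hw, by simp, by simp⟩

theorem sum_repr_smul_coe {ι M : Type*} [Fintype ι] [AddCommGroup M] [Module K M]
    {V : Submodule K M} (b : Module.Basis ι K V) {v : M} (hv : v ∈ V) :
    ∑ i, b.repr ⟨v, hv⟩ i • (b i : M) = v := by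
  have h := congrArg (Subtype.val : V → M) (b.sum_repr ⟨v, hv⟩)
  simpa only [AddSubmonoidClass.coe_finsetSum, Submodule.coe_smul] using h

/-- Coordinates on `𝔭` and on `W` parametrize the set rationally by an affine space with denominator
`det g`, which is nonzero because `g = 1` is allowed. -/
theorem isPrime_vanishingIdeal_orbitPairs [Infinite K] (x : Matrix (Fin n) (Fin n) K)
    (W : Submodule K (Matrix (Fin n) (Fin n) K)) :
    (vanishingIdeal K (orbitPairs c x W)).IsPrime := by
  let b := Module.finBasis K (parabolicLie K c).toSubmodule
  let b' := Module.finBasis K W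
  have hg := IsPolyMat.linearCombination (K := K)
    (Sum.inl : _ → Fin (Module.finrank K (parabolicLie K c).toSubmodule) ⊕
      Fin (Module.finrank K W))
    (fun i => (b i : Matrix (Fin n) (Fin n) K))
  have hw := IsPolyMat.linearCombination (K := K)
    (Sum.inr : _ → Fin (Module.finrank K (parabolicLie K c).toSubmodule) ⊕
      Fin (Module.finrank K W))
    (fun i => (b' i : Matrix (Fin n) (Fin n) K))
  obtain ⟨q, φ, hq, hφ⟩ := exists_conj_polynomials x hg hw
  refine isPrime_vanishingIdeal_of_parametrization q ?_ φ ?_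
  · rintro rfl
    have h := hq (Sum.elim (b.repr ⟨1, one_mem_parabolicLie c⟩) 0)
    simp only [map_zero, Sum.elim_inl, sum_repr_smul_coe b (one_mem_parabolicLie c)] at h
    simp at h
  · intro z
    constructor
    · rintro ⟨g, hg, hdet, w, hw, h₁, h₂⟩
      refine ⟨Sum.elim (b.repr ⟨g, hg⟩) (b'.repr ⟨w, hw⟩), ?_⟩
      have e₁ := sum_repr_smul_coe b hg
      have e₂ := sum_repr_smul_coe b' hw
      rw [hφ _ (by simpa only [Sum.elim_inl, e₁] using hdet), hq]
      simp only [Sum.elim_inl, Sum.elim_inr, e₁, e₂]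
      exact ⟨hdet, h₁, h₂⟩
    · rintro ⟨u, hu, hz⟩
      rw [hq] at hu
      obtain ⟨h₁, h₂⟩ := (hφ u hu z).1 hz
      exact ⟨_, (parabolicLie K c).toSubmodule.sum_mem fun i _ =>
        (parabolicLie K c).toSubmodule.smul_mem _ (b i).2, hu, _,
        W.sum_mem fun i _ => W.smul_mem _ (b' i).2, h₁, h₂⟩

end OrbitPairs

/-! ### Slices to an orbit -/

section Slice

variable {K : Type*} [Field K] {n : ℕ} (c : Composition n)

/-- The centralizer `𝔭^x` as a subspace of the space of matrices. -/
def centralizerSubmodule (x : Matrix (Fin n) (Fin n) K) :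
    Submodule K (Matrix (Fin n) (Fin n) K) where
  carrier := {y | y ∈ parabolicLie K c ∧ x * y = y * x}
  add_mem' := fun ha hb => ⟨add_mem ha.1 hb.1, by rw [mul_add, add_mul, ha.2, hb.2]⟩
  zero_mem' := ⟨zero_mem _, by simp⟩
  smul_mem' := fun r _ ha => ⟨(parabolicLie K c).smul_mem r ha.1, by
    rw [mul_smul_comm, smul_mul_assoc, ha.2]⟩

/-- A subspace `1 + S` that meets the centralizer of `x` transversally at `1`, together with a
left inverse of `v ↦ v x - x v` on `S`. -/
structure Slice (x : Matrix (Fin n) (Fin n) K) where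
  /-- The direction of the slice. -/
  S : Submodule K (Matrix (Fin n) (Fin n) K)
  le_parabolic : S ≤ (parabolicLie K c).toSubmodule
  finrank_add : Module.finrank K S + Module.finrank K (centralizerSubmodule c x) =
    Module.finrank K (parabolicLie K c).toSubmodule
  /-- The left inverse. -/
  Q : Matrix (Fin n) (Fin n) K →ₗ[K] S
  left_inv : ∀ v : S, Q (v * x - x * v) = v

/-- Cut a complement of `𝔭^x` down to `𝔭`; the modular law keeps it a complement there. It meets the
kernel of `v ↦ v x - x v` trivially, whence the left inverse `Q`. -/
theorem nonempty_slice (x : Matrix (Fin n) (Fin n) K) : Nonempty (Slice c x) := by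
  obtain ⟨T, hT⟩ := Submodule.exists_isCompl (centralizerSubmodule c x)
  set p := (parabolicLie K c).toSubmodule
  have hle : centralizerSubmodule c x ≤ p := fun y hy => hy.1
  have hinf : (T ⊓ p) ⊓ centralizerSubmodule c x = ⊥ := by
    rw [eq_bot_iff, ← hT.inf_eq_bot]
    exact fun v hv => ⟨hv.2, hv.1.1⟩
  have hsup : (T ⊓ p) ⊔ centralizerSubmodule c x = p := by
    rw [sup_comm, ← sup_inf_assoc_of_le T hle, hT.sup_eq_top, top_inf_eq]
  have hdim := Submodule.finrank_sup_add_finrank_inf_eq (T ⊓ p) (centralizerSubmodule c x)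
  rw [hinf, hsup, finrank_bot, add_zero] at hdim
  let f : ↥(T ⊓ p) →ₗ[K] Matrix (Fin n) (Fin n) K :=
    (LinearMap.mulRight K x - LinearMap.mulLeft K x).comp (T ⊓ p).subtype
  have hf : ∀ v, f v = v * x - x * v := fun v => rfl
  have hker : LinearMap.ker f = ⊥ := by
    rw [eq_bot_iff]
    intro v hv
    rw [LinearMap.mem_ker, hf, sub_eq_zero] at hv
    have : (v : Matrix (Fin n) (Fin n) K) ∈ (T ⊓ p) ⊓ centralizerSubmodule c x :=
      ⟨v.2, v.2.2, hv.symm⟩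
    rw [hinf, Submodule.mem_bot] at this
    exact Subtype.ext this
  obtain ⟨Q, hQ⟩ := f.exists_leftInverse_of_injective hker
  exact ⟨⟨T ⊓ p, inf_le_right, hdim.symm, Q, fun v => LinearMap.congr_fun hQ v⟩⟩

namespace Slice

variable {c} {x : Matrix (Fin n) (Fin n) K} (s : Slice c x)

/-- The dimension of the slice. -/
noncomputable abbrev dim : ℕ := Module.finrank K s.S

/-- A basis of the direction of the slice. -/
noncomputable abbrev basis : Module.Basis (Fin s.dim) K s.S := Module.finBasis K s.S

/-- The point of the slice with coordinates `a`. -/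
noncomputable def point (a : Fin s.dim → K) : Matrix (Fin n) (Fin n) K :=
  1 + ∑ i, a i • (s.basis i : Matrix (Fin n) (Fin n) K)

/-- The matrix of the linear system for the coordinates of `g ∈ 1 + S` with `g x = y g`. -/
noncomputable def system (y : Matrix (Fin n) (Fin n) K) : Matrix (Fin s.dim) (Fin s.dim) K :=
  Matrix.of fun i j => s.basis.repr (s.Q (s.basis j * x - y * s.basis j)) i

/-- The solution of the linear system by Cramer's rule, multiplied by the determinant. -/
noncomputable def coord (y : Matrix (Fin n) (Fin n) K) (i : Fin s.dim) : K :=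
  ∑ j, (s.system y).adjugate i j * s.basis.repr (s.Q (y - x)) j

/-- A multiple of the solution `g ∈ 1 + S` of `g x = y g`. -/
noncomputable def cramer (y : Matrix (Fin n) (Fin n) K) : Matrix (Fin n) (Fin n) K :=
  (s.system y).det • 1 + ∑ i, s.coord y i • (s.basis i : Matrix (Fin n) (Fin n) K)

theorem sum_mem_S (a : Fin s.dim → K) :
    ∑ i, a i • (s.basis i : Matrix (Fin n) (Fin n) K) ∈ s.S :=
  s.S.sum_mem fun i _ => s.S.smul_mem _ (s.basis i).2

theorem point_mem (a : Fin s.dim → K) : s.point a ∈ parabolicLie K c :=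
  add_mem (one_mem_parabolicLie c) (s.le_parabolic (s.sum_mem_S a))

theorem cramer_mem (y : Matrix (Fin n) (Fin n) K) : s.cramer y ∈ parabolicLie K c :=
  add_mem ((parabolicLie K c).smul_mem _ (one_mem_parabolicLie c))
    (s.le_parabolic (s.sum_mem_S _))

theorem system_mulVec (y : Matrix (Fin n) (Fin n) K) (a : Fin s.dim → K) :
    (s.system y).mulVec a = s.basis.repr (s.Q
      ((∑ i, a i • (s.basis i : Matrix (Fin n) (Fin n) K)) * x -
        y * ∑ i, a i • (s.basis i : Matrix (Fin n) (Fin n) K))) := by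
  have h : (∑ i, a i • (s.basis i : Matrix (Fin n) (Fin n) K)) * x -
        y * ∑ i, a i • (s.basis i : Matrix (Fin n) (Fin n) K) =
      ∑ i, a i • (s.basis i * x - y * s.basis i) := by
    simp only [Finset.sum_mul, Finset.mul_sum, smul_sub, Finset.sum_sub_distrib, smul_mul_assoc,
      mul_smul_comm]
  rw [h]
  funext i
  simp only [Matrix.mulVec, dotProduct, system, Matrix.of_apply, map_sum, map_smul,
    Finsupp.coe_finsetSum, Finset.sum_apply, Finsupp.coe_smul, Pi.smul_apply, smul_eq_mul]
  exact Finset.sum_congr rfl fun j _ => mul_comm _ _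

theorem system_self : s.system x = 1 := by
  ext i j
  simp only [system, Matrix.of_apply, s.left_inv, Module.Basis.repr_self]
  rw [Matrix.one_apply, Finsupp.single_apply]
  simp only [eq_comm]

theorem cramer_self : s.cramer x = 1 := by
  simp [cramer, coord, system_self]

/-- Cramer's rule. Writing `g = 1 + v`, the equation `g x = y g` becomes the linear equation `v x -
y v = y - x`, to which `Q` is applied. -/
theorem coord_eq {y : Matrix (Fin n) (Fin n) K} {a : Fin s.dim → K}
    (h : s.point a * x = y * s.point a) (i : Fin s.dim) :
    s.coord y i = (s.system y).det * a i := by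
  have h1 := s.system_mulVec y a
  have h2 : (∑ i, a i • (s.basis i : Matrix (Fin n) (Fin n) K)) * x -
        y * ∑ i, a i • (s.basis i : Matrix (Fin n) (Fin n) K) = y - x := by
    rw [point, add_mul, mul_add, one_mul, mul_one] at h
    rw [sub_eq_sub_iff_add_eq_add, add_comm, h]
  rw [h2] at h1
  have h3 := congrArg (fun v => (s.system y).adjugate.mulVec v i) h1
  simp only [Matrix.mulVec_mulVec, Matrix.adjugate_mul, Matrix.smul_mulVec, Matrix.one_mulVec] at h3
  exact h3.symm

theorem cramer_eq {y : Matrix (Fin n) (Fin n) K} {a : Fin s.dim → K}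
    (h : s.point a * x = y * s.point a) : s.cramer y = (s.system y).det • s.point a := by
  simp only [cramer, s.coord_eq h, point, smul_add, Finset.smul_sum, mul_smul]

/-- The solutions `l ∈ 𝔭` of `l x = y l` include `g 𝔭^x`, of dimension `dim 𝔭^x`. A nonsingular
system makes this meet `S` only in zero, so the two span `𝔭`; splitting `1` along them gives a
solution in `1 + S`. -/
theorem exists_point {y g : Matrix (Fin n) (Fin n) K} (hg : g ∈ parabolicLie K c)
    (hdet : g.det ≠ 0) (hy : y * g = g * x) (hs : (s.system y).det ≠ 0) :
    ∃ a, s.point a * x = y * s.point a := by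
  let L := (centralizerSubmodule c x).map (LinearMap.mulLeft K g)
  have hL : ∀ l ∈ L, l ∈ parabolicLie K c ∧ l * x = y * l := by
    rintro _ ⟨v, hv, rfl⟩
    refine ⟨mul_mem_parabolicLie c hg hv.1, ?_⟩
    simp only [LinearMap.mulLeft_apply]
    rw [mul_assoc, ← hv.2, ← mul_assoc, ← hy, mul_assoc]
  have hinj : Function.Injective (LinearMap.mulLeft K g) := fun v w hvw =>
    ((Matrix.isUnit_iff_isUnit_det g).2 (IsUnit.mk0 _ hdet)).mul_right_injective hvw
  have hdimL : Module.finrank K L = Module.finrank K (centralizerSubmodule c x) :=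
    ((centralizerSubmodule c x).equivMapOfInjective _ hinj).finrank_eq.symm
  have hinf : s.S ⊓ L = ⊥ := by
    rw [eq_bot_iff]
    rintro v ⟨hvS, hvL⟩
    have h1 := s.system_mulVec y (s.basis.repr ⟨v, hvS⟩)
    rw [sum_repr_smul_coe s.basis hvS, (hL v hvL).2, sub_self, map_zero, map_zero] at h1
    have h2 : ⇑(s.basis.repr ⟨v, hvS⟩) = 0 := Matrix.eq_zero_of_mulVec_eq_zero hs h1
    have h3 : (⟨v, hvS⟩ : s.S) = 0 := by
      rw [← s.basis.repr.map_eq_zero_iff]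
      exact DFunLike.coe_injective h2
    exact congrArg Subtype.val h3
  have hsup : s.S ⊔ L = (parabolicLie K c).toSubmodule := by
    refine Submodule.eq_of_le_of_finrank_eq (sup_le s.le_parabolic fun l hl => (hL l hl).1) ?_
    have := Submodule.finrank_sup_add_finrank_inf_eq s.S L
    rw [hinf, finrank_bot, add_zero] at this
    rw [this, hdimL, s.finrank_add]
  have h1 : (1 : Matrix (Fin n) (Fin n) K) ∈ s.S ⊔ L := by
    rw [hsup]; exact one_mem_parabolicLie c
  obtain ⟨v, hv, l, hl, hvl⟩ := Submodule.mem_sup.1 h1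
  refine ⟨s.basis.repr ⟨-v, neg_mem hv⟩, ?_⟩
  have : s.point (s.basis.repr ⟨-v, neg_mem hv⟩) = l := by
    rw [point, sum_repr_smul_coe s.basis (neg_mem hv), ← hvl]
    abel
  rw [this]
  exact (hL l hl).2

/-! Polynomiality. -/

theorem isPolyMat_system {τ : Type*} {Y : (τ → K) → Matrix (Fin n) (Fin n) K} (hY : IsPolyMat Y) :
    IsPolyMat fun u => s.system (Y u) := fun i _ =>
  ((IsPolyMat.const _).sub (hY.mul (IsPolyMat.const _))).linear
    ((s.basis.coord i).comp s.Q)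

theorem isPolyFun_coord {τ : Type*} {Y : (τ → K) → Matrix (Fin n) (Fin n) K} (hY : IsPolyMat Y)
    (i : Fin s.dim) : IsPolyFun fun u => s.coord (Y u) i :=
  IsPolyFun.sum _ fun j => ((s.isPolyMat_system hY).adjugate i j).mul
    ((hY.sub (IsPolyMat.const x)).linear ((s.basis.coord j).comp s.Q))

theorem isPolyMat_cramer {τ : Type*} {Y : (τ → K) → Matrix (Fin n) (Fin n) K} (hY : IsPolyMat Y) :
    IsPolyMat fun u => s.cramer (Y u) :=
  ((IsPolyMat.const 1).smul (s.isPolyMat_system hY).det).add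
    (IsPolyMat.sum fun i => (IsPolyMat.const _).smul (s.isPolyFun_coord hY i))

end Slice

end Slice

/-! ### Dimension of the set of pairs over an orbit -/

section Estimates

variable {K : Type*} [Field K] {n : ℕ} {c : Composition n} {x : Matrix (Fin n) (Fin n) K}

/-- The polynomial on the space of pairs which is nonzero at the points over the part of the
orbit that is covered by the slice. -/
theorem Slice.exists_polynomial (s : Slice c x) : ∃ q : MvPolynomial (PairIndex n) K,
    ∀ z, aeval z q = (s.system (fstMat z)).det * (s.cramer (fstMat z)).det :=
  (s.isPolyMat_system isPolyMat_fstMat).det.mul (s.isPolyMat_cramer isPolyMat_fstMat).det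

theorem det_ne_zero_of_det_cramer_ne_zero (s : Slice c x) {y : Matrix (Fin n) (Fin n) K}
    {a : Fin s.dim → K} (h : s.point a * x = y * s.point a) (hdet : (s.cramer y).det ≠ 0) :
    (s.point a).det ≠ 0 := by
  rw [s.cramer_eq h, Matrix.det_smul] at hdet
  exact right_ne_zero_of_mul hdet

/-- Orbits with the same closure are equal. -/
theorem exists_conj_of_vanishing {y : Matrix (Fin n) (Fin n) K}
    {W W' : Set (Matrix (Fin n) (Fin n) K)}
    (h₁ : ∀ z ∈ orbitPairs c y W', ∀ p : MvPolynomial (PairIndex n) K,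
      (∀ z' ∈ orbitPairs c x W, aeval z' p = 0) → aeval z p = 0)
    (h₂ : ∀ p : MvPolynomial (PairIndex n) K,
      (∀ z' ∈ orbitPairs c y W', aeval z' p = 0) → aeval (pairCoordinates (x, 0)) p = 0) :
    ∃ g ∈ parabolicLie K c, g.det ≠ 0 ∧ y * g = g * x := by
  obtain ⟨s⟩ := nonempty_slice c x
  obtain ⟨q, hq⟩ := s.exists_polynomial
  have hqx : aeval (pairCoordinates (x, 0)) q ≠ 0 := by
    rw [hq, fstMat_pairCoordinates, s.system_self, s.cramer_self]
    simp
  -- `q` does not vanish at `(x, 0)`, which lies in the closure of the pairs over `y`, so it cannot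
  -- vanish on all of them.
  obtain ⟨z, hz, hqz⟩ : ∃ z ∈ orbitPairs c y W', aeval z q ≠ 0 := by
    by_contra! h
    exact hqx (h₂ q h)
  rw [hq] at hqz
  have hG := s.isPolyMat_cramer (isPolyMat_fstMat (K := K) (n := n))
  -- These polynomials express that `cramer` intertwines `x` with the first matrix. The factor `det
  -- (system)` makes them vanish on all pairs over `x`, including those the slice misses; by `h₁`
  -- they vanish at `z` too.
  choose p hp using IsPolyMat.smul (s.isPolyMat_system isPolyMat_fstMat).det
    ((hG.mul (IsPolyMat.const x)).sub ((isPolyMat_fstMat (K := K) (n := n)).mul hG))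
  beta_reduce at hp
  have hzero : ∀ i j, aeval z (p i j) = 0 := by
    intro i j
    refine h₁ z hz _ ?_
    rintro z' ⟨g, hg, hdet, -, -, hgx, -⟩
    rw [hp]
    by_cases h0 : (s.system (fstMat z')).det = 0
    · simp [h0]
    · obtain ⟨a, ha⟩ := s.exists_point hg hdet hgx h0
      rw [s.cramer_eq ha, smul_mul_assoc, mul_smul_comm, ha]
      simp
  have hmat : s.cramer (fstMat z) * x = fstMat z * s.cramer (fstMat z) := by
    rw [← sub_eq_zero]
    have : (s.system (fstMat z)).det •
        (s.cramer (fstMat z) * x - fstMat z * s.cramer (fstMat z)) = 0 := by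
      ext i j
      exact (hp i j z).symm.trans (hzero i j)
    exact (smul_eq_zero.1 this).resolve_left (left_ne_zero_of_mul hqz)
  obtain ⟨g, hg, hdet, -, -, hgy, -⟩ := hz
  refine ⟨g⁻¹ * s.cramer (fstMat z), mul_mem_parabolicLie c (inv_mem_parabolicLie c hg hdet)
    (s.cramer_mem _), ?_, ?_⟩
  · rw [Matrix.det_mul]
    refine mul_ne_zero ?_ (right_ne_zero_of_mul hqz)
    rw [Matrix.det_nonsing_inv, Ring.inverse_eq_inv']
    exact inv_ne_zero hdet
  · rw [← mul_assoc, ← inv_mul_eq_mul_inv hdet hgy, mul_assoc, ← hmat, mul_assoc]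

/-- Upper bound: the pairs over the orbit of `x` are parametrized, generically, by a slice and
by the fibre. -/
theorem ringKrullDim_orbitPairs_le [Infinite K] (s : Slice c x) {W : Set (Matrix (Fin n) (Fin n) K)}
    (hW : ∀ w ∈ W, ∀ t : K, ∀ h ∈ parabolicLie K c, h.det ≠ 0 → h * x = x * h →
      h⁻¹ * (t • w) * h ∈ W)
    (V : Submodule K (Matrix (Fin n) (Fin n) K)) (hWV : W ⊆ V)
    (J : Ideal (MvPolynomial (Fin s.dim ⊕ Fin (Module.finrank K V)) K))
    (hJ : ∀ u, ∑ i, u (Sum.inr i) • (Module.finBasis K V i : Matrix (Fin n) (Fin n) K) ∈ W →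
      u ∈ zeroLocus K J) :
    ringKrullDim (MvPolynomial (PairIndex n) K ⧸ vanishingIdeal K (orbitPairs c x W)) ≤
      ringKrullDim (MvPolynomial (Fin s.dim ⊕ Fin (Module.finrank K V)) K ⧸ J) := by
  have hg : IsPolyMat fun u : Fin s.dim ⊕ Fin (Module.finrank K V) → K =>
      s.point fun i => u (Sum.inl i) :=
    (IsPolyMat.const 1).add (IsPolyMat.linearCombination Sum.inl _)
  have hw := IsPolyMat.linearCombination (K := K)
    (Sum.inr : _ → Fin s.dim ⊕ Fin (Module.finrank K V))
    (fun i => (Module.finBasis K V i : Matrix (Fin n) (Fin n) K))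
  obtain ⟨qτ, φ, hqτ, hφ⟩ := exists_conj_polynomials x hg hw
  obtain ⟨q, hq⟩ := s.exists_polynomial
  refine ringKrullDim_le_of_parametrization J qτ φ ?_
  rintro p hp z ⟨g, hg, hdet, w, hw, h₁, h₂⟩
  -- `W` need not be irreducible, so work one line `K ∙ w` at a time: the pairs over a line form an
  -- irreducible set on which `q` is not identically zero, so `q` can be cancelled.
  have hprime := isPrime_vanishingIdeal_orbitPairs c x (K ∙ w)
  have hpq : p * q ∈ vanishingIdeal K (orbitPairs c x (K ∙ w : Submodule K _)) := by
    rw [mem_vanishingIdeal_iff]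
    rintro z ⟨g, hg, hdet, w', hw', h₁, h₂⟩
    obtain ⟨t, rfl⟩ := Submodule.mem_span_singleton.1 hw'
    rw [map_mul, mul_eq_zero, or_iff_not_imp_right]
    intro hqz
    rw [hq] at hqz
    obtain ⟨a, ha⟩ := s.exists_point hg hdet h₁ (left_ne_zero_of_mul hqz)
    have hda := det_ne_zero_of_det_cramer_ne_zero s ha (right_ne_zero_of_mul hqz)
    have hgu : IsUnit g.det := IsUnit.mk0 _ hdet
    have hau : IsUnit (s.point a).det := IsUnit.mk0 _ hda
    -- Both `g` and the slice point carry `x` to the same matrix, so they differ by an `h`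
    -- centralizing `x`, which is absorbed into the fibre.
    set h := g⁻¹ * s.point a with hh
    have hgh : g * h = s.point a := by
      rw [hh, ← mul_assoc, Matrix.mul_nonsing_inv _ hgu, one_mul]
    have hhdet : h.det ≠ 0 := by
      intro h0
      apply hda
      rw [← hgh, Matrix.det_mul, h0, mul_zero]
    have hhu : IsUnit h.det := IsUnit.mk0 _ hhdet
    have hcomm : h * x = x * h := by
      rw [hh, mul_assoc, ha, ← mul_assoc, inv_mul_eq_mul_inv hdet h₁, mul_assoc]
    have hmem := hW w hw t h (mul_mem_parabolicLie c (inv_mem_parabolicLie c hg hdet)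
      (s.point_mem a)) hhdet hcomm
    obtain ⟨r, hr⟩ : ∃ r : Fin (Module.finrank K V) → K,
        ∑ i, r i • (Module.finBasis K V i : Matrix (Fin n) (Fin n) K) = h⁻¹ * (t • w) * h :=
      ⟨_, sum_repr_smul_coe (Module.finBasis K V) (hWV hmem)⟩
    have hu := hJ (Sum.elim a r) (by simp only [Sum.elim_inr, hr]; exact hmem)
    have hdu : (s.point fun i => Sum.elim a r (Sum.inl i)).det ≠ 0 := by
      simpa only [Sum.elim_inl] using hda
    refine hp z (Sum.elim a r) hu ?_ ?_
    · rw [hqτ]; exact hdu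
    · refine (hφ (Sum.elim a r) hdu z).2 ?_
      simp only [Sum.elim_inl, Sum.elim_inr, hr]
      refine ⟨ha.symm, ?_⟩
      conv_lhs => rw [← hgh, ← mul_assoc, h₂]
      rw [← hgh, mul_assoc g h, mul_assoc h⁻¹, ← mul_assoc h h⁻¹, Matrix.mul_nonsing_inv _ hhu,
        one_mul, mul_assoc]
  have hqn : q ∉ vanishingIdeal K (orbitPairs c x (K ∙ w : Submodule K _)) := by
    intro h
    have := mem_vanishingIdeal_iff.1 h _
      (pairCoordinates_mem_orbitPairs c x (Submodule.mem_span_singleton_self w))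
    rw [hq, fstMat_pairCoordinates, s.system_self, s.cramer_self] at this
    simp at this
  exact mem_vanishingIdeal_iff.1 ((hprime.mem_or_mem hpq).resolve_right hqn) z
    ⟨g, hg, hdet, w, Submodule.mem_span_singleton_self w, h₁, h₂⟩

/-- Lower bound: if the fibre is a linear space then the pairs over the orbit of `x` dominate the
product of a slice and the fibre. -/
theorem le_ringKrullDim_orbitPairs [Infinite K] (s : Slice c x)
    (V : Submodule K (Matrix (Fin n) (Fin n) K)) :
    ((s.dim + Module.finrank K V : ℕ) : WithBot ℕ∞) ≤
      ringKrullDim (MvPolynomial (PairIndex n) K ⧸ vanishingIdeal K (orbitPairs c x V)) := by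
  let b := Module.finBasis K V
  -- A retraction onto `V` makes the coordinates on `V` polynomial functions of an arbitrary matrix.
  obtain ⟨L, hL⟩ := V.subtype.exists_leftInverse_of_injective V.ker_subtype
  have hg : IsPolyMat fun u : Fin s.dim ⊕ Fin (Module.finrank K V) → K =>
      s.point fun i => u (Sum.inl i) :=
    (IsPolyMat.const 1).add (IsPolyMat.linearCombination Sum.inl _)
  have hw := IsPolyMat.linearCombination (K := K)
    (Sum.inr : _ → Fin s.dim ⊕ Fin (Module.finrank K V))
    (fun i => (b i : Matrix (Fin n) (Fin n) K))
  obtain ⟨qτ, φ, hqτ, hφ⟩ := exists_conj_polynomials x hg hw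
  obtain ⟨q, hq⟩ := s.exists_polynomial
  obtain ⟨δ, hδ⟩ := (s.isPolyMat_system (isPolyMat_fstMat (K := K) (n := n))).det
  have hG := s.isPolyMat_cramer (isPolyMat_fstMat (K := K) (n := n))
  -- Where the first matrix is conjugate to `x` by a slice point with parameters `a`, `coord` is
  -- `det (system) * a`, and with `G = cramer` the product `adj G * sndMat * G` is `det G • w`.
  -- Supplying the missing factor in each gives numerators over the common denominator `q`.
  choose ρ₁ hρ₁ using fun i => (s.isPolyFun_coord (isPolyMat_fstMat (K := K) (n := n)) i).mul hG.det
  choose ρ₂ hρ₂ using fun j => (s.isPolyMat_system isPolyMat_fstMat).det.mul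
    (((hG.adjugate.mul isPolyMat_sndMat).mul hG).linear ((b.coord j).comp L))
  obtain ⟨P, N, hP⟩ := exists_clear_denominators qτ φ δ
  beta_reduce at hδ hρ₁ hρ₂
  have hcard : Fintype.card (Fin s.dim ⊕ Fin (Module.finrank K V)) =
    s.dim + Module.finrank K V := by simp
  rw [← hcard]
  refine card_le_ringKrullDim_of_dominant q (Sum.elim ρ₁ ρ₂) (h := P * qτ) ?_ ?_
  -- At parameter `0` the conjugating matrix is `1` and the pair is `(x, 0)`, where the system is
  -- the identity.
  · intro h0
    have hp0 : s.point (fun i => (0 : Fin s.dim ⊕ Fin (Module.finrank K V) → K) (Sum.inl i)) =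
        1 := by simp [Slice.point]
    have h1 := congrArg (aeval (0 : Fin s.dim ⊕ Fin (Module.finrank K V) → K)) h0
    have h2 := hP 0 (pairCoordinates (x, 0)) ((hφ 0 (by rw [hp0]; simp) _).2 (by
      rw [hp0]; simp))
    rw [map_mul, h2, hδ, hqτ, hp0, fstMat_pairCoordinates, s.system_self] at h1
    simp at h1
  · intro u hu
    rw [map_mul] at hu
    have hdet : (s.point fun i => u (Sum.inl i)).det ≠ 0 := by
      rw [← hqτ]; exact right_ne_zero_of_mul hu
    set g := s.point fun i => u (Sum.inl i) with hgdef
    set w := ∑ i, u (Sum.inr i) • (b i : Matrix (Fin n) (Fin n) K) with hwdef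
    have hgu : IsUnit g.det := IsUnit.mk0 _ hdet
    have hzx : g * x * g⁻¹ * g = g * x := by
      rw [mul_assoc, Matrix.nonsing_inv_mul _ hgu, mul_one]
    have hzw : g * w * g⁻¹ * g = g * w := by
      rw [mul_assoc, Matrix.nonsing_inv_mul _ hgu, mul_one]
    have hwV : w ∈ V := V.sum_mem fun i _ => V.smul_mem _ (b i).2
    set z : PairIndex n → K := pairCoordinates (g * x * g⁻¹, g * w * g⁻¹) with hz
    have hfz : fstMat z = g * x * g⁻¹ := rfl
    have hsz : sndMat z = g * w * g⁻¹ := rfl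
    have hsys : (s.system (fstMat z)).det ≠ 0 := by
      have h2 := hP u z ((hφ u hdet z).2 ⟨hzx, hzw⟩)
      rw [← hδ]
      rw [h2] at hu
      exact right_ne_zero_of_mul (left_ne_zero_of_mul hu)
    have hpt : s.point (fun i => u (Sum.inl i)) * x =
      fstMat z * s.point (fun i => u (Sum.inl i)) := hzx.symm
    have hcr := s.cramer_eq hpt
    have hcrdet : (s.cramer (fstMat z)).det ≠ 0 := by
      rw [hcr, Matrix.det_smul]
      exact mul_ne_zero (pow_ne_zero _ hsys) hdet
    refine ⟨z, ⟨g, s.point_mem _, hdet, w, hwV, hzx, hzw⟩, ?_, ?_⟩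
    · rw [hq]
      exact mul_ne_zero hsys hcrdet
    · rintro (i | j)
      · simp only [Sum.elim_inl, hρ₁, hq, s.coord_eq hpt]
        ring
      · simp only [Sum.elim_inr, hρ₂, hq]
        have h3 : sndMat z * s.cramer (fstMat z) = s.cramer (fstMat z) * w := by
          rw [hcr, mul_smul_comm, smul_mul_assoc, hsz, ← hgdef, hzw]
        rw [mul_assoc (Matrix.adjugate _), h3, ← mul_assoc, Matrix.adjugate_mul, smul_mul_assoc,
          one_mul, map_smul, smul_eq_mul, ← mul_assoc]
        congr 1
        have h4 : L w = ⟨w, hwV⟩ := LinearMap.congr_fun hL ⟨w, hwV⟩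
        have h5 : (⟨w, hwV⟩ : V) = ∑ i, u (Sum.inr i) • b i := by
          apply Subtype.ext
          simp [hwdef]
        rw [LinearMap.comp_apply, h4, h5, Module.Basis.coord_apply, b.repr_sum_self]

end Estimates

/-! ### The fibre over a nilpotent element -/

section Fibre

variable {K : Type*} [Field K] {n : ℕ} (c : Composition n)

/-- The characteristic polynomial is `X ^ n`. The uniform exponent turns nilpotency into polynomial
equations. -/
theorem pow_eq_zero_of_isNilpotent {x : Matrix (Fin n) (Fin n) K} (hx : IsNilpotent x) :
    x ^ n = 0 := by
  have h := (Matrix.isNilpotent_charpoly_sub_pow_of_isNilpotent hx).eq_zero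
  rw [sub_eq_zero, Fintype.card_fin] at h
  have h1 := Matrix.aeval_self_charpoly x
  rwa [h, map_pow, Polynomial.aeval_X] at h1

/-- The nilpotent elements of the centralizer `𝔭^x`. -/
def nilpotentCentralizer (x : Matrix (Fin n) (Fin n) K) : Set (Matrix (Fin n) (Fin n) K) :=
  {w | w ∈ centralizerSubmodule c x ∧ IsNilpotent w}

/-- The traceless elements of the centralizer `𝔭^x`. -/
noncomputable def tracelessCentralizer (x : Matrix (Fin n) (Fin n) K) :
    Submodule K (Matrix (Fin n) (Fin n) K) :=
  centralizerSubmodule c x ⊓ LinearMap.ker (Matrix.traceLinearMap (Fin n) K K)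

theorem mem_tracelessCentralizer {x w : Matrix (Fin n) (Fin n) K} :
    w ∈ tracelessCentralizer c x ↔ w ∈ centralizerSubmodule c x ∧ w.trace = 0 :=
  Iff.rfl

theorem nilpotentCentralizer_subset (x : Matrix (Fin n) (Fin n) K) :
    nilpotentCentralizer c x ⊆ tracelessCentralizer c x :=
  fun _ hw => ⟨hw.1, (Matrix.isNilpotent_trace_of_isNilpotent hw.2).eq_zero⟩

theorem isDistinguished_iff (x : nilpotentCone K c) :
    IsDistinguished K c x ↔ ∀ w ∈ tracelessCentralizer c x.val, IsNilpotent w := by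
  have h : ∀ w, w ∈ parabolicCentralizer K c x.val ∩
      (LieAlgebra.SpecialLinear.sl (Fin n) K : Set _) ↔ w ∈ tracelessCentralizer c x.val := by
    intro w
    rw [mem_tracelessCentralizer]
    refine and_congr (and_congr Iff.rfl ?_) ?_
    · rw [Ring.lie_def, sub_eq_zero]
    · exact Iff.rfl
  constructor
  · intro hx w hw
    exact (hx ((h w).2 hw)).2
  · intro hx w hw
    exact ⟨hw.1.1, hx w ((h w).1 hw)⟩

/-- The identity centralizes `x` and has trace `n`, nonzero in characteristic zero, so the trace is
onto. -/
theorem finrank_tracelessCentralizer [CharZero K] (hn : 0 < n) (x : Matrix (Fin n) (Fin n) K) :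
    Module.finrank K (tracelessCentralizer c x) + 1 =
      Module.finrank K (centralizerSubmodule c x) := by
  set f := (Matrix.traceLinearMap (Fin n) K K).domRestrict (centralizerSubmodule c x) with hf
  have h1 : (1 : Matrix (Fin n) (Fin n) K) ∈ centralizerSubmodule c x :=
    ⟨one_mem_parabolicLie c, by rw [one_mul, mul_one]⟩
  have hne : f ⟨1, h1⟩ ≠ 0 := by
    have : f ⟨1, h1⟩ = (n : K) := by simp [hf]
    rw [this]
    exact Nat.cast_ne_zero.2 hn.ne'
  have hr : LinearMap.range f = ⊤ := by
    rw [LinearMap.range_eq_top]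
    intro a
    exact ⟨(a / f ⟨1, h1⟩) • ⟨1, h1⟩, by rw [map_smul, smul_eq_mul]; field_simp⟩
  have hk := f.finrank_range_add_finrank_ker
  rw [hr, finrank_top, Module.finrank_self] at hk
  have hmap : (LinearMap.ker f).map (centralizerSubmodule c x).subtype =
      tracelessCentralizer c x := by
    rw [hf, LinearMap.ker_domRestrict, Submodule.map_comap_subtype, tracelessCentralizer]
  rw [← hmap, add_comm, ← hk, Submodule.finrank_map_subtype_eq]

theorem conj_mem_nilpotentCentralizer {x w h : Matrix (Fin n) (Fin n) K}
    (hw : w ∈ nilpotentCentralizer c x) (t : K) (hh : h ∈ parabolicLie K c) (hdet : h.det ≠ 0)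
    (hx : h * x = x * h) : h⁻¹ * (t • w) * h ∈ nilpotentCentralizer c x := by
  have hu : IsUnit h.det := IsUnit.mk0 _ hdet
  obtain ⟨⟨hwp, hwx⟩, k, hk⟩ := hw
  have hx' : h⁻¹ * x = x * h⁻¹ := inv_mul_eq_mul_inv hdet hx.symm
  refine ⟨⟨mul_mem_parabolicLie c (mul_mem_parabolicLie c (inv_mem_parabolicLie c hh hdet)
    ((parabolicLie K c).smul_mem t hwp)) hh, ?_⟩, k, ?_⟩
  · rw [← mul_assoc, ← mul_assoc, ← hx', mul_assoc _ h x, hx, mul_assoc h⁻¹ x, mul_smul_comm, hwx,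
      mul_assoc, mul_assoc, smul_mul_assoc, smul_mul_assoc, mul_assoc]
  · have hpow : ∀ j : ℕ, (h⁻¹ * (t • w) * h) ^ j = h⁻¹ * (t • w) ^ j * h := by
      intro j
      induction j with
      | zero => rw [pow_zero, pow_zero, mul_one, Matrix.nonsing_inv_mul _ hu]
      | succ j ih =>
        rw [pow_succ, ih, pow_succ, mul_assoc _ h, mul_assoc h⁻¹ (t • w) h, ← mul_assoc h h⁻¹,
          Matrix.mul_nonsing_inv _ hu, one_mul]
        simp only [mul_assoc]
    rw [hpow, smul_pow, hk, smul_zero, mul_zero, zero_mul]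

variable {c}

theorem Slice.dim_add_finrank [CharZero K] (hn : 0 < n) {x : Matrix (Fin n) (Fin n) K}
    (s : Slice c x) : s.dim + Module.finrank K (tracelessCentralizer c x) + 1 =
      Module.finrank K (parabolicLie K c) := by
  rw [add_assoc, finrank_tracelessCentralizer c hn, s.finrank_add]
  rfl

/-- The fibre sits in the traceless centralizer; with no further equations (`J = ⊥`) the parameter
count is `dim 𝔭 - 1`. -/
theorem ringKrullDim_nilpotent_le [CharZero K] (hn : 0 < n) (x : Matrix (Fin n) (Fin n) K) :
    ringKrullDim (MvPolynomial (PairIndex n) K ⧸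
      vanishingIdeal K (orbitPairs c x (nilpotentCentralizer c x))) + 1 ≤
        Module.finrank K (parabolicLie K c) := by
  obtain ⟨s⟩ := nonempty_slice c x
  have h := ringKrullDim_orbitPairs_le s
    (fun w hw t h hh hdet hx => conj_mem_nilpotentCentralizer c hw t hh hdet hx)
    _ (nilpotentCentralizer_subset c x) ⊥ (by simp)
  have h2 := h.trans (ringKrullDim_quotient_le ⊥)
  rw [ringKrullDim_mvPolynomial_field, Fintype.card_sum, Fintype.card_fin, Fintype.card_fin] at h2
  rw [← s.dim_add_finrank hn]
  push_cast at h2 ⊢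
  gcongr

/-- A traceless `w` in the centralizer that is not nilpotent has a nonzero entry in `w ^ n`. That
entry, as a polynomial on the traceless centralizer, is a nontrivial equation satisfied by the
fibre. -/
theorem ringKrullDim_nilpotent_add_two_le [CharZero K] (hn : 0 < n) {x : nilpotentCone K c}
    (hx : ¬ IsDistinguished K c x) :
    ringKrullDim (MvPolynomial (PairIndex n) K ⧸
      vanishingIdeal K (orbitPairs c x.val (nilpotentCentralizer c x.val))) + 1 + 1 ≤
        Module.finrank K (parabolicLie K c) := by
  obtain ⟨s⟩ := nonempty_slice c x.val
  rw [isDistinguished_iff] at hx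
  push Not at hx
  obtain ⟨w, hw, hnil⟩ := hx
  have hwn : w ^ n ≠ 0 := fun h => hnil ⟨n, h⟩
  obtain ⟨i, j, hij⟩ : ∃ i j, (w ^ n) i j ≠ 0 := by
    by_contra! h
    exact hwn (Matrix.ext h)
  let b := Module.finBasis K (tracelessCentralizer c x.val)
  obtain ⟨f, hf⟩ := (IsPolyMat.linearCombination (K := K)
    (Sum.inr : _ → Fin s.dim ⊕ Fin (Module.finrank K (tracelessCentralizer c x.val)))
    (fun i => (b i : Matrix (Fin n) (Fin n) K))).pow n i j
  beta_reduce at hf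
  have hf0 : f ≠ 0 := by
    rintro rfl
    have := hf (Sum.elim 0 (b.repr ⟨w, hw⟩))
    simp only [Sum.elim_inr, sum_repr_smul_coe b hw, map_zero] at this
    exact hij this.symm
  have h := ringKrullDim_orbitPairs_le s
    (fun w hw t h hh hdet hx => conj_mem_nilpotentCentralizer c hw t hh hdet hx)
    _ (nilpotentCentralizer_subset c x.val) (Ideal.span {f}) (by
      intro u hu
      rw [zeroLocus_span]
      rintro _ rfl
      rw [hf, pow_eq_zero_of_isNilpotent hu.2]
      rfl)
  have h2 := ringKrullDim_quotient_succ_le hf0 (Ideal.mem_span_singleton_self f)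
  rw [Fintype.card_sum, Fintype.card_fin, Fintype.card_fin] at h2
  rw [← s.dim_add_finrank hn]
  push_cast at h2 ⊢
  refine add_le_add_left (le_trans ?_ h2) 1
  gcongr

theorem nilpotentCentralizer_eq {x : nilpotentCone K c} (hx : IsDistinguished K c x) :
    nilpotentCentralizer c x.val = tracelessCentralizer c x.val :=
  (nilpotentCentralizer_subset c x.val).antisymm fun w hw =>
    ⟨hw.1, (isDistinguished_iff c x).1 hx w hw⟩

theorem le_ringKrullDim_nilpotent [CharZero K] (hn : 0 < n) {x : nilpotentCone K c}
    (hx : IsDistinguished K c x) :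
    (Module.finrank K (parabolicLie K c) : WithBot ℕ∞) ≤
      ringKrullDim (MvPolynomial (PairIndex n) K ⧸
        vanishingIdeal K (orbitPairs c x.val (nilpotentCentralizer c x.val))) + 1 := by
  obtain ⟨s⟩ := nonempty_slice c x.val
  rw [nilpotentCentralizer_eq hx, ← s.dim_add_finrank hn]
  have := le_ringKrullDim_orbitPairs s (tracelessCentralizer c x.val)
  push_cast at this ⊢
  gcongr

/-! ### The regular nilpotent element -/

theorem isNilpotent_of_strictlyUpper {y : Matrix (Fin n) (Fin n) K}
    (hy : ∀ i j : Fin n, j ≤ i → y i j = 0) : IsNilpotent y := by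
  have h : ∀ (k : ℕ) (i j : Fin n), (j : ℕ) < i + k → (y ^ k) i j = 0 := by
    intro k
    induction k with
    | zero => intro i j hij; rw [pow_zero, Matrix.one_apply_ne]; rintro rfl; simp at hij
    | succ k ih =>
      intro i j hij
      rw [pow_succ, Matrix.mul_apply]
      refine Finset.sum_eq_zero fun t _ => ?_
      by_cases ht : (t : ℕ) < i + k
      · rw [ih i t ht, zero_mul]
      · rw [hy t j (by rw [Fin.le_def]; omega), mul_zero]
  exact ⟨n, Matrix.ext fun i j => h n i j (by omega)⟩

variable (K n) in
/-- The regular nilpotent matrix: a single Jordan block. -/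
def regularNilpotent : Matrix (Fin n) (Fin n) K :=
  Matrix.of fun i j => if (i : ℕ) + 1 = j then 1 else 0

theorem index_mono {i j : Fin n} (h : i ≤ j) : c.index i ≤ c.index j := by
  by_contra! hlt
  have h1 := c.lt_sizeUpTo_index_succ j
  have h2 := c.sizeUpTo_index_le i
  have h3 : c.sizeUpTo (c.index j).succ ≤ c.sizeUpTo (c.index i) :=
    c.monotone_sizeUpTo (by simpa using hlt)
  rw [Fin.le_def] at h
  omega

variable (c) in
theorem regularNilpotent_mem_nilpotentCone : regularNilpotent K n ∈ nilpotentCone K c := by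
  refine ⟨fun i j hij => ?_, isNilpotent_of_strictlyUpper fun i j hij => ?_⟩
  · refine if_neg fun h => hij.not_ge (index_mono ?_)
    rw [Fin.le_def]; omega
  · refine if_neg fun h => ?_
    rw [Fin.le_def] at hij; omega

/-- Commuting with the Jordan block forces an upper triangular matrix with constant diagonal; trace
zero in characteristic zero kills the diagonal. -/
theorem isDistinguished_regularNilpotent [CharZero K] :
    IsDistinguished K c ⟨regularNilpotent K n, regularNilpotent_mem_nilpotentCone c⟩ := by
  rw [isDistinguished_iff]
  intro y hy
  obtain ⟨⟨-, hcomm⟩, htr⟩ := hy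
  have hentry := fun i j => congrFun (congrFun hcomm i) j
  have hl : ∀ (i j : Fin n) (hi : (i : ℕ) + 1 < n),
      (regularNilpotent K n * y) i j = y ⟨i + 1, hi⟩ j := by
    intro i j hi
    rw [Matrix.mul_apply, Finset.sum_eq_single ⟨i + 1, hi⟩]
    · simp [regularNilpotent]
    · intro t _ ht
      have : ¬ (i : ℕ) + 1 = t := fun h => ht (Fin.ext h.symm)
      simp [regularNilpotent, this]
    · simp
  have hr0 : ∀ (i j : Fin n), (j : ℕ) = 0 → (y * regularNilpotent K n) i j = 0 := by
    intro i j hj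
    rw [Matrix.mul_apply]
    exact Finset.sum_eq_zero fun t _ => by simp [regularNilpotent, hj]
  have hr : ∀ (i j : Fin n) (hj : (j : ℕ) + 1 < n),
      (y * regularNilpotent K n) i ⟨j + 1, hj⟩ = y i j := by
    intro i j hj
    rw [Matrix.mul_apply, Finset.sum_eq_single j]
    · simp [regularNilpotent]
    · intro t _ ht
      have : ¬ (t : ℕ) = j := fun h => ht (Fin.ext h)
      simp [regularNilpotent, this]
    · simp
  have h0 : ∀ (i : ℕ) (hi : i + 1 < n), y ⟨i + 1, hi⟩ ⟨0, by omega⟩ = 0 := by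
    intro i hi
    rw [← hl ⟨i, by omega⟩ _ hi, hentry, hr0 _ _ rfl]
  have h1 : ∀ (i j : ℕ) (hi : i + 1 < n) (hj : j + 1 < n),
      y ⟨i + 1, hi⟩ ⟨j + 1, hj⟩ = y ⟨i, by omega⟩ ⟨j, by omega⟩ := by
    intro i j hi hj
    rw [← hl ⟨i, by omega⟩ _ hi, hentry, hr _ ⟨j, by omega⟩ hj]
  have hlow : ∀ (j i : ℕ) (hi : i < n) (hji : j < i), y ⟨i, hi⟩ ⟨j, by omega⟩ = 0 := by
    intro j
    induction j with
    | zero =>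
      intro i hi hji
      obtain ⟨i, rfl⟩ := Nat.exists_eq_succ_of_ne_zero hji.ne'
      exact h0 i hi
    | succ j ih =>
      intro i hi hji
      obtain ⟨i, rfl⟩ := Nat.exists_eq_succ_of_ne_zero (Nat.zero_lt_of_lt hji).ne'
      exact (h1 i j hi (by omega)).trans (ih i (by omega) (by omega))
  have hdiag : ∀ (i : ℕ) (hi : i < n), y ⟨i, hi⟩ ⟨i, hi⟩ = y ⟨0, by omega⟩ ⟨0, by omega⟩ := by
    intro i
    induction i with
    | zero => intro hi; rfl
    | succ i ih => intro hi; exact (h1 i i hi hi).trans (ih (by omega))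
  refine isNilpotent_of_strictlyUpper fun i j hij => ?_
  rcases hij.lt_or_eq with h | rfl
  · exact hlow j i i.2 h
  · have htr' : y.trace = 0 := htr
    have hn : 0 < n := by have := j.2; omega
    have h2 : y.trace = n * y ⟨0, hn⟩ ⟨0, hn⟩ := by
      have hd : ∀ i : Fin n, y i i = y ⟨0, hn⟩ ⟨0, hn⟩ := fun i => hdiag i i.2
      simp [Matrix.trace, hd]
    rw [htr', eq_comm, mul_eq_zero] at h2
    rw [hdiag j j.2]
    exact h2.resolve_left (Nat.cast_ne_zero.2 hn.ne')

end Fibre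

/-! ### The nilpotent commuting variety -/

section Variety

variable {K : Type*} [Field K] {n : ℕ} (c : Composition n)

/-- The coordinates of a point of the nilpotent commuting variety. -/
def coordinates (z : NilpotentCommutingVariety K c) : PairIndex n → K :=
  pairCoordinates z.val

theorem isClosed_iff_coordinates (Z : Set (NilpotentCommutingVariety K c)) :
    IsClosed Z ↔ ∃ I : Ideal (MvPolynomial (PairIndex n) K),
      Z = coordinates c ⁻¹' zeroLocus K I := by
  refine (@isClosed_induced_iff _ _ (zariskiTopology K _) Z (coordinates c)).trans ?_
  simp only [isClosed_zariskiTopology_iff]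
  constructor
  · rintro ⟨_, ⟨I, rfl⟩, h⟩
    exact ⟨I, h.symm⟩
  · rintro ⟨I, h⟩
    exact ⟨_, ⟨I, rfl⟩, h.symm⟩

theorem isClosed_iff_coordinates_subtype {Z : Set (NilpotentCommutingVariety K c)} (T : Set Z) :
    IsClosed T ↔ ∃ I : Ideal (MvPolynomial (PairIndex n) K),
      T = (fun z : Z => coordinates c z) ⁻¹' zeroLocus K I := by
  rw [isClosed_induced_iff]
  simp only [isClosed_iff_coordinates]
  constructor
  · rintro ⟨_, ⟨I, rfl⟩, h⟩
    exact ⟨I, h.symm⟩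
  · rintro ⟨I, h⟩
    exact ⟨_, ⟨I, rfl⟩, h.symm⟩

/-- The variety is closed in affine space: block triangularity, vanishing `n`-th powers and
commutation are polynomial conditions on the entries. -/
theorem zeroLocus_vanishingIdeal_range_subset :
    zeroLocus K (vanishingIdeal K (Set.range (coordinates (K := K) c))) ⊆
      Set.range (coordinates (K := K) c) := by
  intro u hu
  have hmat : ∀ {Y : (PairIndex n → K) → Matrix (Fin n) (Fin n) K}, IsPolyMat Y → ∀ i j,
      (∀ z : NilpotentCommutingVariety K c, Y (coordinates c z) i j = 0) → Y u i j = 0 := by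
    intro Y hY i j h
    obtain ⟨p, hp⟩ := hY i j
    beta_reduce at hp
    rw [← hp]
    refine hu p (mem_vanishingIdeal_iff.2 ?_)
    rintro _ ⟨z, rfl⟩
    rw [hp, h]
  have h₁ := isPolyMat_fstMat (K := K) (n := n)
  have h₂ := isPolyMat_sndMat (K := K) (n := n)
  refine ⟨⟨(fstMat u, sndMat u), ⟨fun i j hij => ?_, n, Matrix.ext fun i j => ?_⟩,
    ⟨fun i j hij => ?_, n, Matrix.ext fun i j => ?_⟩, Matrix.ext fun i j => ?_⟩,
    pairCoordinates_fstMat_sndMat u⟩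
  · exact hmat h₁ i j fun z => z.2.1.1 hij
  · exact hmat (h₁.pow n) i j fun z =>
      congrFun (congrFun (pow_eq_zero_of_isNilpotent z.2.1.2) i) j
  · exact hmat h₂ i j fun z => z.2.2.1.1 hij
  · exact hmat (h₂.pow n) i j fun z =>
      congrFun (congrFun (pow_eq_zero_of_isNilpotent z.2.2.1.2) i) j
  · exact hmat ((h₁.mul h₂).sub (h₂.mul h₁)) i j fun z => congrFun (congrFun z.2.2.2 i) j

/-- The dimension of a subset of the nilpotent commuting variety, as the Krull dimension of its
coordinate ring. -/
noncomputable def coordDim (A : Set (NilpotentCommutingVariety K c)) : WithBot ℕ∞ :=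
  ringKrullDim (MvPolynomial (PairIndex n) K ⧸ vanishingIdeal K (coordinates c '' A))

variable {c}

theorem topologicalKrullDim_eq_coordDim [IsAlgClosed K] {Z : Set (NilpotentCommutingVariety K c)}
    (hZ : IsClosed Z) : topologicalKrullDim Z = coordDim c Z := by
  have hrange : Set.range (fun z : Z => coordinates c z) = coordinates c '' Z :=
    (Set.image_eq_range _ _).symm
  rw [topologicalKrullDim_eq_ringKrullDim (isClosed_iff_coordinates_subtype c) ?_, hrange]
  · rfl
  · obtain ⟨I, hI⟩ := (isClosed_iff_coordinates c Z).1 hZ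
    refine ⟨I ⊔ vanishingIdeal K (Set.range (coordinates (K := K) c)), ?_⟩
    rw [hrange]
    ext u
    constructor
    · rintro ⟨z, hz, rfl⟩
      have h1 : coordinates c z ∈ zeroLocus K I := by rw [hI] at hz; exact hz
      have h2 : zeroLocus K (I ⊔ vanishingIdeal K (Set.range (coordinates (K := K) c))) =
          zeroLocus K I ∩ zeroLocus K (vanishingIdeal K (Set.range (coordinates (K := K) c))) :=
        zeroLocus_vanishingIdeal_galoisConnection.l_sup
      rw [h2]
      exact ⟨h1, zeroLocus_vanishingIdeal_le _ ⟨z, rfl⟩⟩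
    · intro hu
      obtain ⟨z, rfl⟩ := zeroLocus_vanishingIdeal_range_subset c
        (zeroLocus_anti_mono le_sup_right hu)
      exact ⟨z, by rw [hI]; exact zeroLocus_anti_mono le_sup_left hu, rfl⟩

theorem coordDim_closure (A : Set (NilpotentCommutingVariety K c)) :
    coordDim c (closure A) = coordDim c A := by
  have h : vanishingIdeal K (coordinates c '' closure A) =
      vanishingIdeal K (coordinates c '' A) := by
    refine le_antisymm (vanishingIdeal_anti_mono (Set.image_mono subset_closure)) fun p hp => ?_
    rw [mem_vanishingIdeal_iff, Set.forall_mem_image] at hp ⊢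
    exact fun x hx => (mem_closure_iff_vanishingIdeal (isClosed_iff_coordinates c) A x).1 hx p
      fun a ha => hp ha
  rw [coordDim, h]
  rfl

theorem topologicalKrullDim_mono {X : Type*} [TopologicalSpace X] {A B : Set X} (h : A ⊆ B) :
    topologicalKrullDim A ≤ topologicalKrullDim B :=
  (Topology.IsEmbedding.inclusion h).isInducing.topologicalKrullDim_le

/-- A proper closed subset of an irreducible closed subset has smaller dimension. -/
theorem topologicalKrullDim_succ_le [IsAlgClosed K] {A B : Set (NilpotentCommutingVariety K c)}
    (hA : IsClosed A) (hB : IsClosed B) (hB' : IsIrreducible B) (hAB : A ⊆ B) (hne : A ≠ B) :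
    topologicalKrullDim A + 1 ≤ topologicalKrullDim B := by
  rw [topologicalKrullDim_eq_coordDim hA, topologicalKrullDim_eq_coordDim hB]
  have he := isClosed_iff_coordinates (K := K) c
  have hprime := (isIrreducible_iff_isPrime_vanishingIdeal he B).1 hB'
  have hle : vanishingIdeal K (coordinates c '' B) ≤ vanishingIdeal K (coordinates c '' A) :=
    vanishingIdeal_anti_mono (Set.image_mono hAB)
  obtain ⟨p, hpA, hpB⟩ : ∃ p ∈ vanishingIdeal K (coordinates c '' A),
      p ∉ vanishingIdeal K (coordinates c '' B) := by
    by_contra! h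
    exact hne (eq_of_vanishingIdeal_eq he hA hB (le_antisymm h hle))
  refine ringKrullDim_succ_le_of_surjective (Ideal.Quotient.factor hle)
    (Ideal.Quotient.factor_surjective hle) (r := Ideal.Quotient.mk _ p)
    (mem_nonZeroDivisors_of_ne_zero ?_) ?_
  · rwa [Ne, Ideal.Quotient.eq_zero_iff_mem]
  · rw [Ideal.Quotient.factor_mk, Ideal.Quotient.eq_zero_iff_mem]
    exact hpA

/-- If the largest member of a chain lies in `Z`, the whole chain restricts to `Z`. This transfers
dimension bounds from the orbit pieces to the variety. -/
theorem length_le_topologicalKrullDim {Z : Set (NilpotentCommutingVariety K c)}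
    (l : LTSeries (TopologicalSpace.IrreducibleCloseds (NilpotentCommutingVariety K c)))
    (hl : (l.last : Set (NilpotentCommutingVariety K c)) ⊆ Z) :
    (l.length : WithBot ℕ∞) ≤ topologicalKrullDim Z := by
  have hsub : ∀ i, (l i : Set (NilpotentCommutingVariety K c)) ⊆ Z := fun i =>
    Set.Subset.trans (LTSeries.monotone l (Fin.le_last i)) hl
  have him : ∀ i, (Subtype.val : Z → _) '' (Subtype.val ⁻¹' (l i : Set _)) = (l i : Set _) :=
    fun i => by rw [Subtype.image_preimage_coe, Set.inter_eq_right]; exact hsub i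
  have hirr : ∀ i, IsIrreducible ((Subtype.val : Z → _) ⁻¹' (l i : Set _)) := by
    intro i
    rw [isIrreducible_iff_isPrime_vanishingIdeal (isClosed_iff_coordinates_subtype c)]
    have h := (isIrreducible_iff_isPrime_vanishingIdeal (isClosed_iff_coordinates c) _).1
      (l i).isIrreducible
    rw [← him i, ← Set.image_comp] at h
    exact h
  let F : Fin (l.length + 1) → TopologicalSpace.IrreducibleCloseds Z := fun i =>
    ⟨Subtype.val ⁻¹' (l i : Set _), hirr i, (l i).isClosed.preimage continuous_subtype_val⟩
  have hF : ∀ i : Fin l.length, F i.castSucc < F i.succ := by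
    intro i
    have h : l i.castSucc < l i.succ := l.step i
    have hle : F i.castSucc ≤ F i.succ := fun x hx => h.le hx
    refine lt_of_le_not_ge hle fun h' => h.not_ge fun x hx => ?_
    exact h' (show (⟨x, hsub _ hx⟩ : Z) ∈ Subtype.val ⁻¹' (l i.succ : Set _) from hx)
  let L : LTSeries (TopologicalSpace.IrreducibleCloseds Z) :=
    { length := l.length, toFun := F, step := hF }
  exact Order.LTSeries.length_le_krullDim L

/-! ### Decomposition of the variety into pieces over orbits -/

theorem mul_eq_mul_conj {g x y : Matrix (Fin n) (Fin n) K} (h : y * g = g * x) (k : ℕ) :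
    y ^ k * g = g * x ^ k := by
  induction k with
  | zero => simp
  | succ k ih => rw [pow_succ, mul_assoc, h, ← mul_assoc, ih, mul_assoc, ← pow_succ]

theorem eq_of_mul_eq_mul {g x y : Matrix (Fin n) (Fin n) K} (hg : g.det ≠ 0)
    (h : x * g = y * g) : x = y :=
  ((Matrix.isUnit_iff_isUnit_det g).2 (IsUnit.mk0 _ hg)).mul_left_injective h

theorem mem_orbit_iff_exists {x y : nilpotentCone K c} :
    y ∈ MulAction.orbit (parabolic K c) x ↔
      ∃ g ∈ parabolicLie K c, g.det ≠ 0 ∧ y.val * g = g * x.val := by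
  constructor
  · rintro ⟨g, rfl⟩
    refine ⟨(g : GL (Fin n) K).val, g.2, ?_, ?_⟩
    · exact ((Matrix.isUnit_iff_isUnit_det _).1 (g : GL (Fin n) K).isUnit).ne_zero
    · change (g • x).val * _ = _
      rw [val_smul_nilpotentCone, mul_assoc, Units.inv_mul, mul_one]
  · rintro ⟨g, hg, hdet, h⟩
    let G := Matrix.GeneralLinearGroup.mkOfDetNeZero g hdet
    refine ⟨⟨G, hg⟩, Subtype.ext ?_⟩
    change ((⟨G, hg⟩ : parabolic K c) • x).val = _
    rw [val_smul_nilpotentCone]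
    have hG : (G : Matrix (Fin n) (Fin n) K) = g := rfl
    change (G : Matrix (Fin n) (Fin n) K) * x.val * ((G⁻¹ : GL (Fin n) K) : Matrix _ _ K) = _
    rw [hG, ← h, ← hG, mul_assoc, Units.mul_inv, mul_one]

theorem image_commutingPairsOver {O : NilpotentOrbit K c} {x : nilpotentCone K c}
    (hx : x ∈ O.orbit) : coordinates c '' commutingPairsOver K c O =
      orbitPairs c x.val (nilpotentCentralizer c x.val) := by
  rw [MulAction.orbitRel.Quotient.mem_orbit] at hx
  subst hx
  ext u
  constructor
  · rintro ⟨z, hz, rfl⟩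
    obtain ⟨g, hg, hdet, h⟩ := mem_orbit_iff_exists.1 hz
    have hu : IsUnit g.det := IsUnit.mk0 _ hdet
    have h' : z.val.1 * g = g * x.val := h
    have hcomm : z.val.1 * z.val.2 = z.val.2 * z.val.1 := by
      have := z.2.2.2
      rwa [Ring.lie_def, sub_eq_zero] at this
    have hw : z.val.2 * g = g * (g⁻¹ * z.val.2 * g) := by
      rw [← mul_assoc, ← mul_assoc, Matrix.mul_nonsing_inv _ hu, one_mul]
    have hinj : Function.Injective (fun m => g * m) :=
      ((Matrix.isUnit_iff_isUnit_det g).2 hu).mul_right_injective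
    refine ⟨g, hg, hdet, g⁻¹ * z.val.2 * g, ⟨⟨mul_mem_parabolicLie c
      (mul_mem_parabolicLie c (inv_mem_parabolicLie c hg hdet) z.2.2.1.1) hg, hinj ?_⟩, n,
        hinj ?_⟩, h', hw⟩
    · change g * (x.val * _) = g * (_ * x.val)
      rw [← mul_assoc, ← h', mul_assoc, ← hw, ← mul_assoc, hcomm, mul_assoc, h', ← mul_assoc, hw,
        mul_assoc]
    · change g * _ = g * 0
      rw [← mul_eq_mul_conj hw, pow_eq_zero_of_isNilpotent z.2.2.1.2, zero_mul, mul_zero]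
  · rintro ⟨g, hg, hdet, w, ⟨⟨hwp, hwx⟩, hwn⟩, h₁, h₂⟩
    have hu : IsUnit g.det := IsUnit.mk0 _ hdet
    have hmem : ∀ {y v : Matrix (Fin n) (Fin n) K}, v ∈ parabolicLie K c → IsNilpotent v →
        y * g = g * v → y ∈ nilpotentCone K c := by
      intro y v hv hvn h
      refine ⟨?_, n, eq_of_mul_eq_mul hdet ?_⟩
      · have hy : y = g * v * g⁻¹ := by
          rw [← h, mul_assoc, Matrix.mul_nonsing_inv _ hu, mul_one]
        rw [hy]
        exact mul_mem_parabolicLie c (mul_mem_parabolicLie c hg hv) (inv_mem_parabolicLie c hg hdet)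
      · rw [mul_eq_mul_conj h, pow_eq_zero_of_isNilpotent hvn, mul_zero, zero_mul]
    have hcomm : ⁅fstMat u, sndMat u⁆ = 0 := by
      rw [Ring.lie_def, sub_eq_zero]
      refine eq_of_mul_eq_mul hdet ?_
      rw [mul_assoc, h₂, ← mul_assoc, h₁, mul_assoc, hwx, ← mul_assoc, ← h₂, mul_assoc, ← h₁,
        mul_assoc]
    refine ⟨⟨(fstMat u, sndMat u), hmem x.2.1 x.2.2 h₁, hmem hwp hwn h₂, hcomm⟩, ?_,
      pairCoordinates_fstMat_sndMat u⟩
    exact mem_orbit_iff_exists.2 ⟨g, hg, hdet, h₁⟩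

/-- The finitely many closures cover the variety, so an irreducible set lies in one of them. -/
theorem exists_subset_closure_of_isIrreducible [Finite (NilpotentOrbit K c)]
    {T : Set (NilpotentCommutingVariety K c)} (hT : IsIrreducible T) :
    ∃ O : NilpotentOrbit K c, T ⊆ closure (commutingPairsOver K c O) := by
  have hfin := Set.finite_range fun O : NilpotentOrbit K c => closure (commutingPairsOver K c O)
  obtain ⟨Z, hZ, hTZ⟩ := isIrreducible_iff_sUnion_isClosed.1 hT hfin.toFinset
    (fun Z hZ => by
      obtain ⟨O, rfl⟩ := hfin.mem_toFinset.1 hZ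
      exact isClosed_closure)
    (fun z _ => by
      rw [hfin.coe_toFinset]
      refine ⟨_, ⟨Quotient.mk'' z.fst, rfl⟩, subset_closure ?_⟩
      exact MulAction.mem_orbit_self z.fst)
  obtain ⟨O, rfl⟩ := hfin.mem_toFinset.1 hZ
  exact ⟨O, hTZ⟩

theorem topologicalKrullDim_closure_commutingPairsOver [IsAlgClosed K] {O : NilpotentOrbit K c}
    {x : nilpotentCone K c} (hx : x ∈ O.orbit) :
    topologicalKrullDim (closure (commutingPairsOver K c O)) =
      ringKrullDim (MvPolynomial (PairIndex n) K ⧸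
        vanishingIdeal K (orbitPairs c x.val (nilpotentCentralizer c x.val))) := by
  rw [topologicalKrullDim_eq_coordDim isClosed_closure, coordDim_closure, coordDim,
    image_commutingPairsOver hx]

theorem isIrreducible_closure_commutingPairsOver [Infinite K] {O : NilpotentOrbit K c}
    (hO : O ∈ distinguishedOrbits K c) : IsIrreducible (closure (commutingPairsOver K c O)) := by
  obtain ⟨x, hx⟩ := MulAction.orbitRel.Quotient.nonempty_orbit O
  rw [isIrreducible_iff_closure, isIrreducible_iff_isPrime_vanishingIdeal
    (isClosed_iff_coordinates c), image_commutingPairsOver hx, nilpotentCentralizer_eq (hO x hx)]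
  exact isPrime_vanishingIdeal_orbitPairs c x.val _

/-- Holds for all orbits, not only distinguished ones: `exists_conj_of_vanishing` applies because
`(x, 0)` lies over the orbit of `x`. -/
theorem injective_closure_commutingPairsOver :
    Function.Injective fun O : NilpotentOrbit K c => closure (commutingPairsOver K c O) := by
  intro O O' h
  obtain ⟨x, hx⟩ := MulAction.orbitRel.Quotient.nonempty_orbit O
  obtain ⟨y, hy⟩ := MulAction.orbitRel.Quotient.nonempty_orbit O'
  have hcl : closure (commutingPairsOver K c O) = closure (commutingPairsOver K c O') := h
  have hmem : ∀ z, z ∈ closure (commutingPairsOver K c O) ↔ _ :=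
    mem_closure_iff_vanishingIdeal (isClosed_iff_coordinates c) _
  have hmem' : ∀ z, z ∈ closure (commutingPairsOver K c O') ↔ _ :=
    mem_closure_iff_vanishingIdeal (isClosed_iff_coordinates c) _
  obtain ⟨g, hg, hdet, hgx⟩ := exists_conj_of_vanishing (c := c) (x := x.val) (y := y.val)
    (W := nilpotentCentralizer c x.val) (W' := nilpotentCentralizer c y.val) (by
      intro z hz p hp
      rw [← image_commutingPairsOver hy] at hz
      obtain ⟨z, hz, rfl⟩ := hz
      refine (hmem z).1 (hcl ▸ subset_closure hz) p fun a ha => hp _ ?_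
      rw [← image_commutingPairsOver hx]
      exact ⟨a, ha, rfl⟩) (by
      intro p hp
      have h0 : pairCoordinates (x.val, 0) ∈ coordinates c '' commutingPairsOver K c O := by
        rw [image_commutingPairsOver hx]
        exact pairCoordinates_mem_orbitPairs c _ ⟨zero_mem _, IsNilpotent.zero⟩
      obtain ⟨z, hz, hz0⟩ := h0
      rw [← hz0]
      refine (hmem' z).1 (hcl ▸ subset_closure hz) p fun a ha => hp _ ?_
      rw [← image_commutingPairsOver hy]
      exact ⟨a, ha, rfl⟩)
  rw [MulAction.orbitRel.Quotient.mem_orbit] at hx hy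
  rw [← hx, ← hy, eq_comm, Quotient.eq'']
  exact mem_orbit_iff_exists.2 ⟨g, hg, hdet, hgx⟩

/-! ### Dimension and maximal components of the variety -/

variable [IsAlgClosed K] [CharZero K]

theorem topologicalKrullDim_orbit_le (hn : 0 < n) (O : NilpotentOrbit K c) :
    topologicalKrullDim (closure (commutingPairsOver K c O)) + 1 ≤
      Module.finrank K (parabolicLie K c) := by
  obtain ⟨x, hx⟩ := MulAction.orbitRel.Quotient.nonempty_orbit O
  rw [topologicalKrullDim_closure_commutingPairsOver hx]
  exact ringKrullDim_nilpotent_le hn x.val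

theorem topologicalKrullDim_orbit_add_two_le (hn : 0 < n) {O : NilpotentOrbit K c}
    (hO : O ∉ distinguishedOrbits K c) :
    topologicalKrullDim (closure (commutingPairsOver K c O)) + 1 + 1 ≤
      Module.finrank K (parabolicLie K c) := by
  simp only [distinguishedOrbits, Set.mem_ofPred_eq, not_forall] at hO
  obtain ⟨x, hx, hxd⟩ := hO
  rw [topologicalKrullDim_closure_commutingPairsOver hx]
  exact ringKrullDim_nilpotent_add_two_le hn hxd

theorem le_topologicalKrullDim_orbit (hn : 0 < n) {O : NilpotentOrbit K c} {x : nilpotentCone K c}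
    (hx : x ∈ O.orbit) (hxd : IsDistinguished K c x) :
    (Module.finrank K (parabolicLie K c) : WithBot ℕ∞) ≤
      topologicalKrullDim (closure (commutingPairsOver K c O)) + 1 := by
  rw [topologicalKrullDim_closure_commutingPairsOver hx]
  exact le_ringKrullDim_nilpotent hn hxd

theorem lt_of_add_one_le_natCast {a : WithBot ℕ∞} {N : ℕ} (h : a + 1 ≤ N) : a < N := by
  cases a with
  | bot => exact WithBot.bot_lt_coe _
  | coe a =>
    have h' : a + 1 ≤ (N : ℕ∞) := WithBot.coe_le_coe.1 h
    exact WithBot.coe_lt_coe.2 ((ENat.add_one_le_iff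
      (ne_top_of_le_ne_top (ENat.natCast_ne_top N) (le_self_add.trans h'))).1 h')

theorem le_of_add_one_le_natCast {a b : WithBot ℕ∞} {N : ℕ} (h : a + 1 ≤ N)
    (h' : N ≤ b + 1) : a ≤ b := by
  cases a with
  | bot => exact bot_le
  | coe a =>
    cases b with
    | bot =>
      rw [WithBot.bot_add] at h'
      exact absurd (le_bot_iff.1 h') WithBot.coe_ne_bot
    | coe b =>
      have h1 : a + 1 ≤ b + 1 := WithBot.coe_le_coe.1 (h.trans h')
      exact WithBot.coe_le_coe.2 ((ENat.add_le_add_iff_right ENat.one_ne_top).1 h1)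

/-- A strictly larger irreducible closed set would have dimension at least `dim 𝔭`, contrary to
`hlt`. Both parts of the theorem rest on this. -/
theorem closure_commutingPairsOver_mem_irreducibleComponents (hn : 0 < n) {O : NilpotentOrbit K c}
    (hO : O ∈ distinguishedOrbits K c)
    (hlt : topologicalKrullDim (NilpotentCommutingVariety K c) <
      Module.finrank K (parabolicLie K c)) :
    closure (commutingPairsOver K c O) ∈
      irreducibleComponents (NilpotentCommutingVariety K c) := by
  obtain ⟨T, hT, hOT⟩ := exists_mem_irreducibleComponents_subset_of_isIrreducible _
    (isIrreducible_closure_commutingPairsOver hO)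
  by_cases hne : closure (commutingPairsOver K c O) = T
  · rwa [hne]
  · exfalso
    obtain ⟨x, hx⟩ := MulAction.orbitRel.Quotient.nonempty_orbit O
    refine hlt.not_ge ?_
    exact (le_topologicalKrullDim_orbit hn hx (hO x hx)).trans
      ((topologicalKrullDim_succ_le isClosed_closure (isClosed_of_mem_irreducibleComponents T hT)
        hT.1 hOT hne).trans (topologicalKrullDim_subspace_le _ T))

theorem topologicalKrullDim_add_one_eq [Finite (NilpotentOrbit K c)] (hn : 0 < n) :
    topologicalKrullDim (NilpotentCommutingVariety K c) + 1 =
      Module.finrank K (parabolicLie K c) := by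
  apply le_antisymm
  · obtain ⟨N, hN⟩ := Nat.exists_eq_succ_of_ne_zero (n := Module.finrank K (parabolicLie K c)) (by
      obtain ⟨s⟩ := nonempty_slice (K := K) c 0
      rw [← s.dim_add_finrank hn]
      exact Nat.succ_ne_zero _)
    have hle : topologicalKrullDim (NilpotentCommutingVariety K c) ≤ N := by
      refine iSup_le fun l => ?_
      -- The top of any chain lies in one orbit closure, whose dimension bounds the length.
      obtain ⟨O, hO⟩ := exists_subset_closure_of_isIrreducible l.last.isIrreducible
      have h1 := (add_le_add_left (length_le_topologicalKrullDim l hO) 1).trans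
        (topologicalKrullDim_orbit_le hn O)
      rw [hN] at h1
      norm_cast at h1
      exact_mod_cast Nat.le_of_succ_le_succ h1
    rw [hN, Nat.succ_eq_add_one, Nat.cast_add, Nat.cast_one]
    gcongr
  · let O : NilpotentOrbit K c :=
      Quotient.mk'' ⟨regularNilpotent K n, regularNilpotent_mem_nilpotentCone c⟩
    have hO : ⟨regularNilpotent K n, regularNilpotent_mem_nilpotentCone c⟩ ∈ O.orbit :=
      MulAction.mem_orbit_self _
    refine (le_topologicalKrullDim_orbit hn hO isDistinguished_regularNilpotent).trans ?_
    gcongr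
    exact topologicalKrullDim_subspace_le _ _

theorem bijOn_distinguishedOrbits [Finite (NilpotentOrbit K c)] (hn : 0 < n) :
    Set.BijOn (fun O : NilpotentOrbit K c => closure (commutingPairsOver K c O))
      (distinguishedOrbits K c) (maximalDimensionalComponents K c) := by
  have hdim := topologicalKrullDim_add_one_eq (K := K) (c := c) hn
  have hlt := lt_of_add_one_le_natCast hdim.le
  refine ⟨fun O hO => ?_, injective_closure_commutingPairsOver.injOn, ?_⟩
  · refine ⟨closure_commutingPairsOver_mem_irreducibleComponents hn hO hlt,
      le_antisymm (topologicalKrullDim_subspace_le _ _) ?_⟩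
    obtain ⟨x, hx⟩ := MulAction.orbitRel.Quotient.nonempty_orbit O
    have h := le_topologicalKrullDim_orbit hn hx (hO x hx)
    exact le_of_add_one_le_natCast hdim.le h
  · rintro T ⟨hT, hTdim⟩
    obtain ⟨O, hTO⟩ := exists_subset_closure_of_isIrreducible hT.1
    have hO : O ∈ distinguishedOrbits K c := by
      by_contra hO
      -- An orbit that is not distinguished has a closure too small to contain a component of full
      -- dimension.
      have h1 := lt_of_add_one_le_natCast (topologicalKrullDim_orbit_add_two_le hn hO)
      rw [← hdim, ← hTdim] at h1
      exact h1.not_ge (by gcongr; exact topologicalKrullDim_mono hTO)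
    exact ⟨O, hO, (hT.2 (isIrreducible_closure_commutingPairsOver hO) hTO).antisymm hTO⟩

/-- Otherwise distinct distinguished orbits would give distinct components, of which a Noetherian
space has finitely many. -/
theorem le_topologicalKrullDim_of_infinite (hn : 0 < n)
    (h : (distinguishedOrbits K c).Infinite) :
    (Module.finrank K (parabolicLie K c) : WithBot ℕ∞) ≤
      topologicalKrullDim (NilpotentCommutingVariety K c) := by
  by_contra! hlt
  have := noetherianSpace_of_isClosed_iff (isClosed_iff_coordinates (K := K) c)
  refine h (Set.Finite.of_finite_image
    (TopologicalSpace.NoetherianSpace.finite_irreducibleComponents.subset ?_)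
    (injective_closure_commutingPairsOver (K := K) (c := c)).injOn)
  rintro _ ⟨O, hO, rfl⟩
  exact closure_commutingPairsOver_mem_irreducibleComponents hn hO hlt

end Variety
end ParabolicCommuting

theorem mainTheorem6 {K : Type*} [Field K] [IsAlgClosed K] [CharZero K] {n : ℕ} (hn : 0 < n)
    (c : Composition n) :
    (Finite (ParabolicCommuting.NilpotentOrbit K c) →
      topologicalKrullDim (ParabolicCommuting.NilpotentCommutingVariety K c) + 1 =
          (Module.finrank K (ParabolicCommuting.parabolicLie K c) : WithBot ℕ∞) ∧
        Set.BijOn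
          (fun O : ParabolicCommuting.NilpotentOrbit K c =>
            closure (ParabolicCommuting.commutingPairsOver K c O))
          (ParabolicCommuting.distinguishedOrbits K c)
          (ParabolicCommuting.maximalDimensionalComponents K c)) ∧
    ((ParabolicCommuting.distinguishedOrbits K c).Infinite →
      (Module.finrank K (ParabolicCommuting.parabolicLie K c) : WithBot ℕ∞) ≤
        topologicalKrullDim (ParabolicCommuting.NilpotentCommutingVariety K c)) := by
  refine ⟨fun _ => ?_, ?_⟩
  · exact ⟨ParabolicCommuting.topologicalKrullDim_add_one_eq hn,
      ParabolicCommuting.bijOn_distinguishedOrbits hn⟩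
  · exact ParabolicCommuting.le_topologicalKrullDim_of_infinite hn
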